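/- **Proposition (Supermodular ordering of Markov processes).** A function $f\colon\mathbb R^d\to\mathbb R$ is *supermodular* if $f(x)+f(y)\le f(x\wedge y)+f(x\vee y)$ for all $x,y\in\mathbb R^d$, with componentwise minimum and maximum. For a *weight* $b\colon\mathbb R^d\to[1,\infty)$ (measurable) and random vectors $V,W$ in $\mathbb R^d$, write $V\le_{sm}W$ if $\mathbb E\,b(V)<\infty$, $\mathbb E\,b(W)<\infty$ and $\mathbb E f(V)\le\mathbb E f(W)$ for all measurable supermodular $f$ with $\sup_x|f(x)|/b(x)<\infty$. Fix a weight $b_d$ on $\mathbb R^d$ for every $d$. For real-valued processes, $(V_i)_{i\in\mathbb N_0}\le_{sm}(W_i)_{i\in\mathbb N_0}$ means $(V_{n_1},\dots,V_{n_m})\le_{sm}(W_{n_1},\dots,W_{n_m})$ (with weight $b_m$) for all $m$ and all $n_1,\dots,n_m\in\mathbb N_0$. A process $V$ is *positive supermodular dependent* (PSMD) if $V^\perp\le_{sm}V$, where $V^\perp$ has independent components and $V^\perp_i\overset{d}{=}V_i$ for all $i$. For real random variables, $V\uparrow_{st}U$ means that, for $u$ outside a null set of the law of $U$, the conditional law of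 $V$ given $U=u$ is increasing in $u$ with respect to the usual stochastic order. Let $X=(X_i)_{i\in\mathbb N_0}$ and $Y=(Y_i)_{i\in\mathbb N_0}$ be real-valued discrete-time Markov processes. Assume that the weights are integrable in terms of the marginals: for $Z\in\{X,Y\}$, all $m$ and all $n_1,\dots,n_m\in\mathbb N_0$ there are $c\in\mathbb R$ and functions $\beta_1,\dots,\beta_m\colon\mathbb R\to\mathbb R$ with $\mathbb E|\beta_k(Z_{n_k})|<\infty$ and $b_m(x)\le c+\sum_{k=1}^m\beta_k(x_k)$ for all $x\in\mathbb R^m$ (this is automatic for bounded weights, and holds for $b_m(x)=\max\{1,\|x\|^p\}$ if all $X_i,Y_i$ have finite $p$-th absolute moments). Assume for all $i\in\mathbb N_0$ that 1. $X_{i+1}\uparrow_{st}X_i$, 2. $Y_i\uparrow_{st}Y_{i+1}$, 3. $(X_i,X_{i+1})\le_{sm}(Y_i,Y_{i+1})$ (resp. $(X_i,X_{i+1})\ge_{sm}(Y_i,Y_{i+1})$). Then $X\le_{sm}Y$ (resp. $X\ge_{sm}Y$). Moreover, in both cases $X$ and $Y$ are PSMD. -/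

import Mathlib

open MeasureTheory ProbabilityTheory

/-- `f (x) + f (y) ≤ f (x ∧ y) + f (x ∨ y)` with componentwise minimum and maximum. -/
def Supermodular {d : ℕ} (f : (Fin d → ℝ) → ℝ) : Prop :=
  ∀ x y : Fin d → ℝ, f x + f y ≤ f (x ⊓ y) + f (x ⊔ y)

/-- A weight function on `ℝ^d`: measurable with values in `[1, ∞)`. -/
def IsWeight {d : ℕ} (b : (Fin d → ℝ) → ℝ) : Prop :=
  Measurable b ∧ ∀ x, 1 ≤ b x

/-- Supermodular order of two laws on `ℝ^d` with respect to the weight `b`: both laws integrate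
`b`, and the integrals of all measurable `b`-bounded supermodular functions are ordered. -/
def SupermodularLE {d : ℕ} (b : (Fin d → ℝ) → ℝ) (μ ν : Measure (Fin d → ℝ)) : Prop :=
  Integrable b μ ∧ Integrable b ν ∧
    ∀ f : (Fin d → ℝ) → ℝ, Measurable f → Supermodular f →
      (∃ C : ℝ, ∀ x, |f x| ≤ C * b x) → ∫ x, f x ∂μ ≤ ∫ x, f x ∂ν

/-- Supermodular order of the laws of two real sequences, through all finite-dimensional
marginals; `b d` is the weight function used in dimension `d`. -/
def ProcessSupermodularLE (b : (d : ℕ) → (Fin d → ℝ) → ℝ) (μ ν : Measure (ℕ → ℝ)) : Prop :=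
  ∀ (m : ℕ) (n : Fin m → ℕ),
    SupermodularLE (b m) (μ.map fun x k => x (n k)) (ν.map fun x k => x (n k))

/-- The law of a sequence of random variables. -/
noncomputable def processLaw {Ω : Type*} [MeasurableSpace Ω] (P : Measure Ω) (X : ℕ → Ω → ℝ) :
    Measure (ℕ → ℝ) :=
  P.map fun ω i => X i ω

/-- The law of `(X i, X (i + 1))`. -/
noncomputable def consecutiveLaw {Ω : Type*} [MeasurableSpace Ω] (P : Measure Ω)
    (X : ℕ → Ω → ℝ) (i : ℕ) : Measure (Fin 2 → ℝ) :=
  P.map fun ω => ![X i ω, X (i + 1) ω]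

/-- The law of an independent sequence with the same one-dimensional marginals as `X`. -/
noncomputable def independentLaw {Ω : Type*} [MeasurableSpace Ω] (P : Measure Ω)
    (X : ℕ → Ω → ℝ) : Measure (ℕ → ℝ) :=
  Measure.infinitePi fun i => P.map (X i)

/-- Positive supermodular dependence: the process exceeds, in the supermodular order, the
independent process with the same marginals. -/
def IsPSMD {Ω : Type*} [MeasurableSpace Ω] (b : (d : ℕ) → (Fin d → ℝ) → ℝ) (P : Measure Ω)
    (X : ℕ → Ω → ℝ) : Prop :=
  ProcessSupermodularLE b (independentLaw P X) (processLaw P X)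

/-- The usual stochastic order `μ ≤_st ν` of laws on `ℝ`. -/
def StochasticLE (μ ν : Measure ℝ) : Prop :=
  ∀ f : ℝ → ℝ, Monotone f → Integrable f μ → Integrable f ν → ∫ v, f v ∂μ ≤ ∫ v, f v ∂ν

/-- `V ↑_st U`: outside a null set of the law of `U`, the conditional law of `V` given `U = u` is
increasing in `u` with respect to the stochastic order. -/
def StochasticallyIncreasing {Ω : Type*} [MeasurableSpace Ω] (P : Measure Ω) [IsFiniteMeasure P]
    (V U : Ω → ℝ) : Prop :=
  ∃ S : Set ℝ, (∀ᵐ u ∂(P.map U), u ∈ S) ∧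
    ∀ u ∈ S, ∀ u' ∈ S, u ≤ u' → StochasticLE (condDistrib V U P u) (condDistrib V U P u')

/-- Markov process in discrete time: measurable, and the conditional probabilities of the next
state given the whole past and given the present state agree almost surely. -/
def IsMarkovProcess {Ω : Type*} [MeasurableSpace Ω] (P : Measure Ω) (X : ℕ → Ω → ℝ) : Prop :=
  (∀ i, Measurable (X i)) ∧
    ∀ (n : ℕ) (B : Set ℝ), MeasurableSet B →
      P⟦X (n + 1) ⁻¹' B | ⨆ j ≤ n, MeasurableSpace.comap (X j) inferInstance⟧ =ᵐ[P]
        P⟦X (n + 1) ⁻¹' B | MeasurableSpace.comap (X n) inferInstance⟧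

/-- The weights are integrable along `X` in terms of the one-dimensional marginals: the weight on
each finite-dimensional marginal of `X` is bounded by a sum of integrable functions of the single
components. It covers bounded weights for every `X`, and `max 1 (‖x‖ ^ p)` whenever every `X i` has
a finite absolute moment of order `p`. It puts every finite-dimensional marginal of `X`, and its
independent version, into the class of `b`-integrable vectors. -/
def MarginallyIntegrable {Ω : Type*} [MeasurableSpace Ω] (b : (d : ℕ) → (Fin d → ℝ) → ℝ)
    (P : Measure Ω) (X : ℕ → Ω → ℝ) : Prop :=
  ∀ (m : ℕ) (n : Fin m → ℕ), ∃ (c : ℝ) (β : Fin m → ℝ → ℝ),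
    (∀ k, Integrable (β k) (P.map (X (n k)))) ∧ ∀ x, b m x ≤ c + ∑ k, β k (x k)

/-! Let `μ` be a chain with stochastically increasing forward kernels `κ n`, and `ν` one with the
same marginals and stochastically increasing backward kernels `η n`. Integrating out an end
coordinate of a supermodular function against an increasing kernel leaves it supermodular
(`SeqSupermodular.resample`). Hence the last coordinates can be integrated out forward under `μ`,
leaving a supermodular function of two consecutive coordinates, where the pair hypothesis applies.
As forward and backward integrations commute, this compares the `μ`-integral of `F` with that of `F`
after the backward transition of `ν` has been applied to its first coordinate
(`comparison_resample`). The new function is supermodular with one coordinate fewer, and induction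
gives `comparison_of_stochMono`. The relation `r` there is `≤` or `≥`, so both directions have one
proof.

Three gaps remain. Conditional laws increase only off a null set: in the `arctan` scale they extend
to kernels increasing everywhere (`monotoneExtension`). Weighted test functions may be unbounded:
clamping the coordinates and subtracting functions of single coordinates, whose integrals agree,
reduces them to bounded ones (`ClampedLE.integral_le`). For PSMD, the independent sequence is itself
a chain with constant, hence increasing, kernels in both directions, so it can be either of the two
chains; its pair hypothesis is a symmetrization argument
(`integral_independent_le_of_aeStochIncreasing`). -/

open Set Filter Topology

/-! ### Test functions and integration of one coordinate against a kernel. -/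

/-- Bounded measurable functions on sequence space that depend only on the coordinates in `A`. -/
structure IsTest (F : (ℕ → ℝ) → ℝ) (A : Set ℕ) : Prop where
  measurable : Measurable F
  bounded : ∃ C, ∀ x, |F x| ≤ C
  dependsOn : DependsOn F A

/-- Supermodularity of functions on sequence space. -/
def SeqSupermodular (F : (ℕ → ℝ) → ℝ) : Prop :=
  ∀ x y : ℕ → ℝ, F x + F y ≤ F (x ⊓ y) + F (x ⊔ y)

/-- Integrate out the coordinate `j` with respect to the kernel `κ` evaluated at coordinate `i`. -/
noncomputable def resample (κ : Kernel ℝ ℝ) (i j : ℕ) (F : (ℕ → ℝ) → ℝ) (x : ℕ → ℝ) : ℝ :=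
  ∫ z, F (Function.update x j z) ∂κ (x i)

/-- Among the coordinates in `A`, the kernel `κ` at coordinate `i` is the conditional law of
coordinate `j` given the others. -/
def Disintegrates (μ : Measure (ℕ → ℝ)) (κ : Kernel ℝ ℝ) (i j : ℕ) (A : Set ℕ) : Prop :=
  ∀ F, IsTest F A → ∫ x, F x ∂μ = ∫ x, resample κ i j F x ∂μ

/-- Stochastic monotonicity of a kernel, in terms of distribution functions. -/
def StochMono (κ : Kernel ℝ ℝ) : Prop :=
  ∀ u u', u ≤ u' → ∀ t, κ u' (Iic t) ≤ κ u (Iic t)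

lemma measurable_update_pair (j : ℕ) :
    Measurable fun p : (ℕ → ℝ) × ℝ => Function.update p.1 j p.2 := by
  rw [measurable_pi_iff]
  intro k
  by_cases h : k = j
  · subst h; simpa using measurable_snd
  · simp only [Function.update_of_ne h]
    exact (measurable_pi_apply k).comp measurable_fst

namespace IsTest

variable {F G : (ℕ → ℝ) → ℝ} {A B : Set ℕ}

lemma mono (hF : IsTest F A) (h : A ⊆ B) : IsTest F B :=
  ⟨hF.measurable, hF.bounded, hF.dependsOn.mono h⟩

lemma integrable (hF : IsTest F A) (μ : Measure (ℕ → ℝ)) [IsFiniteMeasure μ] : Integrable F μ := by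
  obtain ⟨C, hC⟩ := hF.bounded
  exact Integrable.of_bound hF.measurable.aestronglyMeasurable C (ae_of_all _ hC)

lemma integrable_update (hF : IsTest F A) (x : ℕ → ℝ) (j : ℕ) (p : Measure ℝ) [IsFiniteMeasure p] :
    Integrable (fun z => F (Function.update x j z)) p := by
  obtain ⟨C, hC⟩ := hF.bounded
  exact Integrable.of_bound (hF.measurable.comp (measurable_update x)).aestronglyMeasurable C
    (ae_of_all _ fun z => hC _)

lemma comp {T : (ℕ → ℝ) → (ℕ → ℝ)} (hF : IsTest F A) (hT : Measurable T)
    (hdep : ∀ x y, ∀ i, x i = y i → T x i = T y i) : IsTest (fun x => F (T x)) A := by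
  obtain ⟨C, hC⟩ := hF.bounded
  exact ⟨hF.measurable.comp hT, ⟨C, fun x => hC _⟩,
    fun x y h => hF.dependsOn fun i hi => hdep x y i (h i hi)⟩

lemma resample (hF : IsTest F A) (κ : Kernel ℝ ℝ) [IsMarkovKernel κ] {i j : ℕ}
    (hA : A \ {j} ⊆ B) (hi : i ∈ B) : IsTest (resample κ i j F) B := by
  obtain ⟨C, hC⟩ := hF.bounded
  refine ⟨?_, ⟨C, fun x => ?_⟩, fun x y h => ?_⟩
  · have h : StronglyMeasurable fun p : (ℕ → ℝ) × ℝ => F (Function.update p.1 j p.2) :=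
      (hF.measurable.comp (measurable_update_pair j)).stronglyMeasurable
    exact (h.integral_kernel_prod_right' (κ := κ.comap (fun x : ℕ → ℝ => x i)
      (measurable_pi_apply i))).measurable
  · have := norm_integral_le_of_norm_le_const (μ := κ (x i)) (C := C)
      (f := fun z => F (Function.update x j z)) (ae_of_all _ fun z => hC _)
    simpa [_root_.resample] using this
  · simp only [_root_.resample]
    rw [h i hi]
    congr 1
    ext z
    refine hF.dependsOn fun k hk => ?_
    by_cases hkj : k = j
    · subst hkj; simp
    · simpa [Function.update_of_ne hkj] using h k (hA ⟨hk, hkj⟩)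

end IsTest

/-- Fubini, valid because neither integration removes the coordinate on which the other kernel is
conditioned. -/
lemma resample_comm {F : (ℕ → ℝ) → ℝ} {A : Set ℕ} (hF : IsTest F A) (κ η : Kernel ℝ ℝ)
    [IsMarkovKernel κ] [IsMarkovKernel η] {i j k l : ℕ} (hjl : j ≠ l) (hil : i ≠ l) (hkj : k ≠ j) :
    resample κ i j (resample η k l F) = resample η k l (resample κ i j F) := by
  ext x
  simp only [resample, Function.update_of_ne hkj, Function.update_of_ne hil]
  rw [integral_integral_swap]
  · simp only [Function.update_comm hjl]
  · obtain ⟨C, hC⟩ := hF.bounded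
    refine Integrable.of_bound (Measurable.aestronglyMeasurable ?_) C (ae_of_all _ fun z => hC _)
    refine hF.measurable.comp ?_
    exact (measurable_update_pair l).comp
      (((measurable_update x).comp measurable_fst).prodMk measurable_snd)

/-! ### Increasing kernels preserve supermodularity. -/

lemma measure_lowerSet_le {p q : Measure ℝ} (h : ∀ t, q (Iic t) ≤ p (Iic t)) {L : Set ℝ}
    (hL : IsLowerSet L) : q L ≤ p L := by
  by_cases hmax : ∃ a, IsGreatest L a
  · obtain ⟨a, ha, hub⟩ := hmax
    have : L = Iic a := Subset.antisymm (fun x hx => hub hx) fun x hx => hL hx ha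
    rw [this]; exact h a
  -- Without a greatest element, a lower set is a directed countable union of rational rays, so
  -- continuity from below applies.
  · have hU : L = ⋃ r : {r : ℚ // (r : ℝ) ∈ L}, Iic ((r : ℚ) : ℝ) := by
      ext x
      simp only [mem_iUnion, mem_Iic]
      constructor
      · intro hx
        have : ∃ y ∈ L, x < y := by
          by_contra! hcon
          exact hmax ⟨x, hx, hcon⟩
        obtain ⟨y, hy, hxy⟩ := this
        obtain ⟨r, hxr, hry⟩ := exists_rat_btwn hxy
        exact ⟨⟨r, hL hry.le hy⟩, hxr.le⟩
      · rintro ⟨r, hr⟩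
        exact hL hr r.2
    have hd : Directed (· ⊆ ·) fun r : {r : ℚ // (r : ℝ) ∈ L} => Iic ((r : ℚ) : ℝ) :=
      directed_of_isDirected_le fun r s hrs => Iic_subset_Iic.2 (by exact_mod_cast hrs)
    rw [hU, hd.measure_iUnion, hd.measure_iUnion]
    exact iSup_mono fun r => h _

/-- Layer cake formula: the superlevel sets of a monotone function have lower sets as complements.
Adding `C` makes the integrand nonnegative. -/
lemma integral_le_of_measure_Iic_le {p q : Measure ℝ} [IsProbabilityMeasure p]
    [IsProbabilityMeasure q] (h : ∀ t, q (Iic t) ≤ p (Iic t)) {g : ℝ → ℝ} (hg : Monotone g)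
    {C : ℝ} (hC : ∀ z, |g z| ≤ C) : ∫ z, g z ∂p ≤ ∫ z, g z ∂q := by
  have key : ∫ z, (g z + C) ∂p ≤ ∫ z, (g z + C) ∂q := by
    have hn : ∀ z, 0 ≤ g z + C := fun z => by linarith [neg_le_of_abs_le (hC z)]
    have hm : Measurable fun z => g z + C := hg.measurable.add_const C
    rw [integral_eq_lintegral_of_nonneg_ae (ae_of_all _ hn) hm.aestronglyMeasurable,
      integral_eq_lintegral_of_nonneg_ae (ae_of_all _ hn) hm.aestronglyMeasurable]
    refine ENNReal.toReal_mono ?_ ?_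
    · have hi : Integrable (fun z => g z + C) q :=
        Integrable.of_bound hm.aestronglyMeasurable (C + C) (ae_of_all _ fun z => by
          rw [Real.norm_eq_abs, abs_of_nonneg (hn z)]
          linarith [le_of_abs_le (hC z)])
      exact (hi.lintegral_lt_top).ne
    · rw [lintegral_eq_lintegral_meas_lt _ (ae_of_all _ hn) hm.aemeasurable,
        lintegral_eq_lintegral_meas_lt _ (ae_of_all _ hn) hm.aemeasurable]
      refine lintegral_mono fun t => ?_
      have hms : MeasurableSet {a | g a + C ≤ t} := measurableSet_le hm measurable_const
      have hlow : IsLowerSet {a | g a + C ≤ t} := fun a b hba ha =>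
        (add_le_add_left (hg hba) C).trans ha
      have hc : {a | t < g a + C} = {a | g a + C ≤ t}ᶜ := by ext; simp
      show p {a | t < g a + C} ≤ q {a | t < g a + C}
      rw [hc, prob_compl_eq_one_sub hms, prob_compl_eq_one_sub hms]
      exact tsub_le_tsub_left (measure_lowerSet_le h hlow) 1
  have hi : ∀ r : Measure ℝ, IsProbabilityMeasure r → ∫ z, (g z + C) ∂r = ∫ z, g z ∂r + C := by
    intro r _
    rw [integral_add (Integrable.of_bound hg.measurable.aestronglyMeasurable C (ae_of_all _ hC))
      (integrable_const C)]
    simp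
  rw [hi p inferInstance, hi q inferInstance] at key
  linarith

lemma StochMono.integral_le {κ : Kernel ℝ ℝ} [IsMarkovKernel κ] (hκ : StochMono κ) {u u' : ℝ}
    (hu : u ≤ u') {g : ℝ → ℝ} (hg : Monotone g) {C : ℝ} (hC : ∀ z, |g z| ≤ C) :
    ∫ z, g z ∂κ u ≤ ∫ z, g z ∂κ u' :=
  integral_le_of_measure_Iic_le (hκ u u' hu) hg hC

lemma update_inf_update (x y : ℕ → ℝ) (j : ℕ) (z w : ℝ) :
    Function.update x j z ⊓ Function.update y j w = Function.update (x ⊓ y) j (z ⊓ w) := by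
  ext k
  by_cases h : k = j
  · subst h; simp
  · simp [Function.update_of_ne h]

lemma update_sup_update (x y : ℕ → ℝ) (j : ℕ) (z w : ℝ) :
    Function.update x j z ⊔ Function.update y j w = Function.update (x ⊔ y) j (z ⊔ w) := by
  ext k
  by_cases h : k = j
  · subst h; simp
  · simp [Function.update_of_ne h]

lemma SeqSupermodular.monotone_sub {F : (ℕ → ℝ) → ℝ} (hF : SeqSupermodular F) {x y : ℕ → ℝ}
    (hxy : x ≤ y) (j : ℕ) :
    Monotone fun z => F (Function.update y j z) - F (Function.update x j z) := by
  intro z w hzw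
  have := hF (Function.update y j z) (Function.update x j w)
  rw [update_inf_update, update_sup_update, inf_eq_right.2 hxy, sup_eq_left.2 hxy,
    inf_eq_left.2 hzw, sup_eq_right.2 hzw] at this
  show F _ - F _ ≤ F _ - F _
  linarith

/-- If `x i ≤ y i`, the meet is integrated against `κ (x i)` and the join against `κ (y i)`.
Supermodularity at a common value `z` bounds the increment from `x ⊓ y` to `x` by that from `y` to
`x ⊔ y`, both under `κ (x i)`. The latter increment is monotone in `z`, so it only grows when `κ (x
i)` is replaced by `κ (y i)`. -/
lemma SeqSupermodular.resample {F : (ℕ → ℝ) → ℝ} (hF : SeqSupermodular F) {A : Set ℕ}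
    (hT : IsTest F A) {κ : Kernel ℝ ℝ} [IsMarkovKernel κ] (hκ : StochMono κ) (i j : ℕ) :
    SeqSupermodular (resample κ i j F) := by
  have main : ∀ x y : ℕ → ℝ, x i ≤ y i →
      _root_.resample κ i j F x + _root_.resample κ i j F y ≤
        _root_.resample κ i j F (x ⊓ y) + _root_.resample κ i j F (x ⊔ y) := by
    intro x y hxy
    obtain ⟨C, hC⟩ := hT.bounded
    have hI : ∀ (w : ℕ → ℝ) (u : ℝ), Integrable (fun z => F (Function.update w j z)) (κ u) :=
      fun w u => hT.integrable_update w j _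
    have h1 := hκ.integral_le hxy (hF.monotone_sub (le_sup_right : y ≤ x ⊔ y) j) (C := C + C)
      fun z => (abs_sub _ _).trans (add_le_add (hC _) (hC _))
    have h2 : ∫ z, (F (Function.update x j z) - F (Function.update (x ⊓ y) j z)) ∂κ (x i) ≤
        ∫ z, (F (Function.update (x ⊔ y) j z) - F (Function.update y j z)) ∂κ (x i) := by
      refine integral_mono ((hI _ _).sub (hI _ _)) ((hI _ _).sub (hI _ _)) fun z => ?_
      have := hF (Function.update x j z) (Function.update y j z)
      rw [update_inf_update, update_sup_update, inf_idem, sup_idem] at this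
      show F _ - F _ ≤ F _ - F _
      linarith
    rw [integral_sub (hI _ _) (hI _ _), integral_sub (hI _ _) (hI _ _)] at h1 h2
    simp only [_root_.resample, Pi.inf_apply, Pi.sup_apply, inf_eq_left.2 hxy, sup_eq_right.2 hxy]
    linarith
  intro x y
  rcases le_total (x i) (y i) with h | h
  · exact main x y h
  · have := main y x h
    rw [inf_comm, sup_comm] at this
    linarith

/-! ### Comparison of chains with increasing kernels. -/

/-- Reversal of the Markov property. -/
lemma Disintegrates.backward {μ : Measure (ℕ → ℝ)} {κ : ℕ → Kernel ℝ ℝ} [∀ n, IsMarkovKernel (κ n)]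
    {η : Kernel ℝ ℝ} [IsMarkovKernel η] (hκ : ∀ n, Disintegrates μ (κ n) n (n + 1) (Iic (n + 1)))
    {n : ℕ} (hη : Disintegrates μ η (n + 1) n {n, n + 1}) (N : ℕ) :
    Disintegrates μ η (n + 1) n (Icc n N) := by
  have main : ∀ k, Disintegrates μ η (n + 1) n (Icc n (n + 1 + k)) := by
    intro k
    induction k with
    | zero =>
      intro F hF
      refine hη F (hF.mono fun i hi => ?_)
      simp only [mem_Icc] at hi
      simp only [mem_insert_iff, mem_singleton_iff]
      omega
    | succ k ih =>
      intro F hF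
      have hF1 : IsTest (resample (κ (n + 1 + k)) (n + 1 + k) (n + 1 + k + 1) F)
          (Icc n (n + 1 + k)) := by
        refine hF.resample _ (fun i hi => ?_) ?_
        · simp only [Set.mem_sdiff, mem_Icc, mem_singleton_iff] at hi ⊢; omega
        · simp only [mem_Icc]; omega
      have hF2 : IsTest (resample η (n + 1) n F) (Iic (n + 1 + k + 1)) := by
        refine hF.resample _ (fun i hi => ?_) ?_
        · simp only [Set.mem_sdiff, mem_Icc, mem_Iic, mem_singleton_iff] at hi ⊢; omega
        · simp only [mem_Iic]; omega
      -- Integrate out the last coordinate forward, use the backward kernel on the shorter window,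
      -- exchange the two integrations and restore the last coordinate.
      rw [hκ (n + 1 + k) F (hF.mono Icc_subset_Iic_self), ih _ hF1,
        resample_comm hF _ _ (by omega) (by omega) (by omega), ← hκ (n + 1 + k) _ hF2]
  intro F hF
  exact main N F (hF.mono (Icc_subset_Icc_right (by omega)))

section Comparison

variable {μ ν : Measure (ℕ → ℝ)} {κ η : ℕ → Kernel ℝ ℝ} [∀ n, IsMarkovKernel (κ n)]
  [∀ n, IsMarkovKernel (η n)] {r : ℝ → ℝ → Prop}

/-- Replacing one backward transition of the first chain by that of the second one. -/
lemma comparison_resample (hκ : ∀ n, Disintegrates μ (κ n) n (n + 1) (Iic (n + 1)))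
    (hη : ∀ n N, Disintegrates ν (η n) (n + 1) n (Icc n N))
    (hκm : ∀ n, StochMono (κ n))
    (hmarg : ∀ n F, IsTest F {n} → ∫ x, F x ∂μ = ∫ x, F x ∂ν)
    (hpair : ∀ n F, IsTest F {n, n + 1} → SeqSupermodular F → r (∫ x, F x ∂μ) (∫ x, F x ∂ν))
    (j k : ℕ) {F : (ℕ → ℝ) → ℝ} (hF : IsTest F (Icc j (j + 1 + k))) (hs : SeqSupermodular F) :
    r (∫ x, F x ∂μ) (∫ x, resample (η j) (j + 1) j F x ∂μ) := by
  induction k generalizing F with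
  | zero =>
    have h1 : IsTest (resample (η j) (j + 1) j F) {j + 1} := by
      refine hF.resample _ (fun i hi => ?_) rfl
      simp only [Set.mem_sdiff, mem_Icc, mem_singleton_iff] at hi ⊢; omega
    -- After the backward integration only coordinate `j + 1` is left, so `μ` may be replaced by
    -- `ν`, under which that integration changes nothing; the pair hypothesis remains.
    rw [hmarg (j + 1) _ h1, ← hη j _ F hF]
    refine hpair j F (hF.mono fun i hi => ?_) hs
    simp only [mem_Icc] at hi
    simp only [mem_insert_iff, mem_singleton_iff]
    omega
  | succ k ih =>
    have hF1 : IsTest (resample (κ (j + 1 + k)) (j + 1 + k) (j + 1 + k + 1) F)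
        (Icc j (j + 1 + k)) := by
      refine hF.resample _ (fun i hi => ?_) ?_
      · simp only [Set.mem_sdiff, mem_Icc, mem_singleton_iff] at hi ⊢; omega
      · simp only [mem_Icc]; omega
    have hF2 : IsTest (resample (η j) (j + 1) j F) (Iic (j + 1 + k + 1)) := by
      refine hF.resample _ (fun i hi => ?_) ?_
      · simp only [Set.mem_sdiff, mem_Icc, mem_Iic, mem_singleton_iff] at hi ⊢; omega
      · simp only [mem_Iic]; omega
    have := ih hF1 (hs.resample hF (hκm _) _ _)
    rwa [resample_comm hF _ _ (by omega) (by omega) (by omega), ← hκ (j + 1 + k) _ hF2,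
      ← hκ (j + 1 + k) F (hF.mono Icc_subset_Iic_self)] at this

/-- Comparison of Markov chains with stochastically monotone transitions: `μ` forward and `ν`
backward in time. -/
theorem comparison_of_stochMono (hrefl : ∀ a, r a a) (htrans : ∀ a b c, r a b → r b c → r a c)
    (hκ : ∀ n, Disintegrates μ (κ n) n (n + 1) (Iic (n + 1)))
    (hη : ∀ n N, Disintegrates ν (η n) (n + 1) n (Icc n N))
    (hκm : ∀ n, StochMono (κ n)) (hηm : ∀ n, StochMono (η n))
    (hmarg : ∀ n F, IsTest F {n} → ∫ x, F x ∂μ = ∫ x, F x ∂ν)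
    (hpair : ∀ n F, IsTest F {n, n + 1} → SeqSupermodular F → r (∫ x, F x ∂μ) (∫ x, F x ∂ν))
    {N : ℕ} {F : (ℕ → ℝ) → ℝ} (hF : IsTest F (Iic N)) (hs : SeqSupermodular F) :
    r (∫ x, F x ∂μ) (∫ x, F x ∂ν) := by
  have main : ∀ k j, ∀ F : (ℕ → ℝ) → ℝ, IsTest F (Icc j (j + k)) → SeqSupermodular F →
      r (∫ x, F x ∂μ) (∫ x, F x ∂ν) := by
    intro k
    induction k with
    | zero =>
      intro j F hF _
      rw [hmarg j F (hF.mono (by simp))]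
      exact hrefl _
    | succ k ih =>
      intro j F hF hs
      have hF' : IsTest F (Icc j (j + 1 + k)) := hF.mono (Icc_subset_Icc_right (by omega))
      have h1 : IsTest (resample (η j) (j + 1) j F) (Icc (j + 1) (j + 1 + k)) := by
        refine hF.resample _ (fun i hi => ?_) ?_
        · simp only [Set.mem_sdiff, mem_Icc, mem_singleton_iff] at hi ⊢; omega
        · simp only [mem_Icc]; omega
      refine htrans _ _ _ (comparison_resample hκ hη hκm hmarg hpair j k hF' hs) ?_
      rw [hη j _ F hF]
      exact ih (j + 1) _ h1 (hs.resample hF (hηm j) _ _)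
  exact main N 0 F (hF.mono fun i hi => by simpa using hi) hs

end Comparison

/-! ### Extending an almost surely increasing kernel to an increasing one. -/

/-- The pointwise infimum of a family of distribution functions. -/
noncomputable def infCDF (A : Set (Measure ℝ)) : StieltjesFunction ℝ where
  toFun t := ⨅ m : A, cdf m.1 t
  mono' s t hst := ciInf_mono ⟨0, by rintro _ ⟨m, rfl⟩; exact cdf_nonneg _ _⟩
    fun m => monotone_cdf _ hst
  -- Monotonicity gives the lower bound; for the upper one, a single member close to the infimum at
  -- `x` stays close just to the right of `x`.
  right_continuous' x := by
    have hbdd : ∀ t, BddBelow (range fun m : A => cdf m.1 t) :=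
      fun t => ⟨0, by rintro _ ⟨m, rfl⟩; exact cdf_nonneg _ _⟩
    rcases isEmpty_or_nonempty A with hA | hA
    · simp only [Real.iInf_of_isEmpty]
      exact continuousWithinAt_const
    refine tendsto_order.2 ⟨fun a ha => ?_, fun a ha => ?_⟩
    · filter_upwards [self_mem_nhdsWithin] with y hy
      exact ha.trans_le (ciInf_mono (hbdd x) fun m => monotone_cdf _ hy)
    · obtain ⟨m, hm⟩ := exists_lt_of_ciInf_lt ha
      filter_upwards [((cdf m.1).right_continuous x).eventually_lt_const hm] with y hy
      exact (ciInf_le (hbdd y) m).trans_lt hy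

lemma infCDF_apply (A : Set (Measure ℝ)) (t : ℝ) : infCDF A t = ⨅ m : A, cdf m.1 t := rfl

lemma infCDF_le {A : Set (Measure ℝ)} {m : Measure ℝ} (hm : m ∈ A) (t : ℝ) :
    infCDF A t ≤ cdf m t :=
  ciInf_le (f := fun m : A => cdf m.1 t)
    ⟨0, by rintro _ ⟨m, rfl⟩; exact cdf_nonneg _ _⟩ ⟨m, hm⟩

lemma infCDF_nonneg (A : Set (Measure ℝ)) (t : ℝ) : 0 ≤ infCDF A t :=
  Real.iInf_nonneg fun _ => cdf_nonneg _ _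

/-- The laws of `arctan V` under the kernel at states of `S` up to `u` in the `arctan` scale,
together with a law that is below all of them. -/
def lowerLaws (κ : Kernel ℝ ℝ) (S : Set ℝ) (u : ℝ) : Set (Measure ℝ) :=
  {m | m = Measure.dirac (-2) ∨ ∃ s ∈ S, Real.arctan s ≤ u ∧ m = (κ s).map Real.arctan}

lemma cdf_map_arctan_of_le (p : Measure ℝ) [IsProbabilityMeasure p] {t : ℝ} (ht : 2 ≤ t) :
    cdf (p.map Real.arctan) t = 1 := by
  have := Measure.isProbabilityMeasure_map (μ := p) Real.measurable_arctan.aemeasurable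
  rw [cdf_eq_real, map_measureReal_apply Real.measurable_arctan measurableSet_Iic]
  have : Real.arctan ⁻¹' Iic t = univ := by
    ext x
    simp only [mem_preimage, mem_Iic, mem_univ, iff_true]
    linarith [Real.arctan_lt_pi_div_two x, Real.pi_le_four]
  simp [this]

lemma cdf_map_arctan_of_lt (p : Measure ℝ) [IsProbabilityMeasure p] {t : ℝ} (ht : t < -2) :
    cdf (p.map Real.arctan) t = 0 := by
  have := Measure.isProbabilityMeasure_map (μ := p) Real.measurable_arctan.aemeasurable
  rw [cdf_eq_real, map_measureReal_apply Real.measurable_arctan measurableSet_Iic]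
  have : Real.arctan ⁻¹' Iic t = ∅ := by
    ext x
    simp only [mem_preimage, mem_Iic, mem_empty_iff_false, iff_false, not_le]
    linarith [Real.neg_pi_div_two_lt_arctan x, Real.pi_le_four]
  simp [this]

lemma cdf_dirac_of_le {a t : ℝ} (h : a ≤ t) : cdf (Measure.dirac a) t = 1 := by
  rw [cdf_eq_real]; simp [measureReal_def, h]

lemma cdf_dirac_of_lt {a t : ℝ} (h : t < a) : cdf (Measure.dirac a) t = 0 := by
  rw [cdf_eq_real]; simp [measureReal_def, h]

section Extension

variable (κ : Kernel ℝ ℝ) (S : Set ℝ)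

/-- The family of laws grows with `u`, so the infimum decreases. -/
lemma antitone_infCDF (t : ℝ) : Antitone fun u => infCDF (lowerLaws κ S u) t := by
  intro u v huv
  have : Nonempty (lowerLaws κ S u) := ⟨⟨_, Or.inl rfl⟩⟩
  refine le_ciInf fun m => infCDF_le ?_ t
  rcases m.2 with h | ⟨s, hs, hsu, h⟩
  · exact Or.inl h
  · exact Or.inr ⟨s, hs, hsu.trans huv, h⟩

lemma tendsto_infCDF_atBot (u : ℝ) : Tendsto (infCDF (lowerLaws κ S u)) atBot (𝓝 0) := by
  refine tendsto_const_nhds.congr' ?_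
  filter_upwards [eventually_lt_atBot (-2 : ℝ)] with t ht
  refine le_antisymm (infCDF_nonneg _ _) ((infCDF_le (Or.inl rfl) t).trans ?_)
  rw [cdf_dirac_of_lt ht]

lemma measure_infCDF_Iic (u t : ℝ) : (infCDF (lowerLaws κ S u)).measure (Iic t) =
    ENNReal.ofReal (infCDF (lowerLaws κ S u) t) := by
  rw [StieltjesFunction.measure_Iic _ (tendsto_infCDF_atBot κ S u), sub_zero]

variable [IsMarkovKernel κ]

/-- This is the reason for the `arctan` scale: all laws live on `[-2, 2]`, whereas an infimum over
arbitrary laws could lose mass at infinity. The Dirac mass keeps the family nonempty. -/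
lemma tendsto_infCDF_atTop (u : ℝ) : Tendsto (infCDF (lowerLaws κ S u)) atTop (𝓝 1) := by
  refine tendsto_const_nhds.congr' ?_
  filter_upwards [eventually_ge_atTop (2 : ℝ)] with t ht
  rw [infCDF_apply]
  have : Nonempty (lowerLaws κ S u) := ⟨⟨_, Or.inl rfl⟩⟩
  have h1 : ∀ m : lowerLaws κ S u, cdf m.1 t = 1 := by
    rintro ⟨m, rfl | ⟨s, -, -, rfl⟩⟩
    · exact cdf_dirac_of_le (by linarith)
    · exact cdf_map_arctan_of_le _ ht
  simp [h1]

instance isProbabilityMeasure_infCDF (u : ℝ) :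
    IsProbabilityMeasure (infCDF (lowerLaws κ S u)).measure :=
  StieltjesFunction.isProbabilityMeasure _ (tendsto_infCDF_atBot κ S u) (tendsto_infCDF_atTop κ S u)

/-- The kernel `κ` in the `arctan` scale, extended from `S` to a stochastically monotone kernel. -/
noncomputable def monotoneExtension : Kernel ℝ ℝ where
  toFun u := (infCDF (lowerLaws κ S u)).measure
  measurable' := by
    refine .measure_of_isPiSystem_of_isProbabilityMeasure (borel_eq_generateFrom_Iic ℝ)
      isPiSystem_Iic ?_
    rintro _ ⟨t, rfl⟩
    simp_rw [measure_infCDF_Iic]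
    exact (antitone_infCDF κ S t).measurable.ennreal_ofReal

instance : IsMarkovKernel (monotoneExtension κ S) :=
  ⟨fun u => isProbabilityMeasure_infCDF κ S u⟩

lemma stochMono_monotoneExtension : StochMono (monotoneExtension κ S) := by
  intro u v huv t
  change (infCDF (lowerLaws κ S v)).measure (Iic t) ≤ (infCDF (lowerLaws κ S u)).measure (Iic t)
  rw [measure_infCDF_Iic, measure_infCDF_Iic]
  exact ENNReal.ofReal_le_ofReal (antitone_infCDF κ S t huv)

variable {κ S}

/-- The law at `s` belongs to its own family and, by monotonicity on `S`, has the smallest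
distribution function there. The Dirac mass at `-2` has the largest one and does not affect the
infimum. -/
lemma monotoneExtension_arctan
    (hS : ∀ u ∈ S, ∀ u' ∈ S, u ≤ u' → StochasticLE (κ u) (κ u')) {s : ℝ} (hs : s ∈ S) :
    monotoneExtension κ S (Real.arctan s) = (κ s).map Real.arctan := by
  have hp : ∀ u, IsProbabilityMeasure ((κ u).map Real.arctan) := fun u =>
    Measure.isProbabilityMeasure_map Real.measurable_arctan.aemeasurable
  have := hp s
  refine Measure.eq_of_cdf _ _ ?_
  change cdf (infCDF (lowerLaws κ S (Real.arctan s))).measure = _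
  rw [cdf_measure_stieltjesFunction _ (tendsto_infCDF_atBot κ S _) (tendsto_infCDF_atTop κ S _)]
  ext t
  refine le_antisymm (infCDF_le (Or.inr ⟨s, hs, le_rfl, rfl⟩) t) ?_
  have : Nonempty (lowerLaws κ S (Real.arctan s)) := ⟨⟨_, Or.inl rfl⟩⟩
  refine le_ciInf ?_
  rintro ⟨m, rfl | ⟨s', hs', hle, rfl⟩⟩
  · rcases lt_or_ge t (-2) with h | h
    · rw [cdf_map_arctan_of_lt _ h]; exact cdf_nonneg _ _
    · rw [cdf_dirac_of_le h]; exact cdf_le_one _ _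
  · have hle' : s' ≤ s := Real.arctan_strictMono.le_iff_le.1 hle
    have := hp s'
    rw [cdf_eq_real, cdf_eq_real, map_measureReal_apply Real.measurable_arctan measurableSet_Iic,
      map_measureReal_apply Real.measurable_arctan measurableSet_Iic]
    have hm : MeasurableSet (Real.arctan ⁻¹' Iic t) := Real.measurable_arctan measurableSet_Iic
    have hmono : Monotone ((Real.arctan ⁻¹' Iic t)ᶜ.indicator fun _ => (1 : ℝ)) := by
      intro a b hab
      by_cases ha : a ∈ (Real.arctan ⁻¹' Iic t)ᶜ
      · have hb : b ∈ (Real.arctan ⁻¹' Iic t)ᶜ := fun hb => ha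
          ((Real.arctan_strictMono.monotone hab).trans hb)
        simp [indicator_of_mem ha, indicator_of_mem hb]
      · rw [indicator_of_notMem ha]
        exact indicator_nonneg (fun _ _ => zero_le_one) _
    have hI : ∀ u, Integrable ((Real.arctan ⁻¹' Iic t)ᶜ.indicator fun _ => (1 : ℝ)) (κ u) :=
      fun u => (integrable_const _).indicator hm.compl
    have h := hS s' hs' s hs hle' _ hmono (hI _) (hI _)
    rw [integral_indicator_const _ hm.compl, integral_indicator_const _ hm.compl,
      probReal_compl_eq_one_sub hm, probReal_compl_eq_one_sub hm] at h
    simp only [smul_eq_mul, mul_one] at h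
    linarith

end Extension

/-! ### Transfer of the comparison through the `arctan` scale. -/

/-- The coordinatewise `arctan`. -/
noncomputable def seqArctan (x : ℕ → ℝ) : ℕ → ℝ := fun i => Real.arctan (x i)

lemma measurable_seqArctan : Measurable seqArctan :=
  measurable_pi_iff.2 fun i => Real.measurable_arctan.comp (measurable_pi_apply i)

lemma seqArctan_update (x : ℕ → ℝ) (j : ℕ) (z : ℝ) :
    seqArctan (Function.update x j z) = Function.update (seqArctan x) j (Real.arctan z) := by
  ext k
  by_cases h : k = j
  · subst h; simp [seqArctan]
  · simp [seqArctan, Function.update_of_ne h]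

lemma IsTest.comp_seqArctan {F : (ℕ → ℝ) → ℝ} {A : Set ℕ} (hF : IsTest F A) :
    IsTest (fun x => F (seqArctan x)) A :=
  hF.comp measurable_seqArctan fun x y i h => by simp [seqArctan, h]

lemma Disintegrates.map_seqArctan {μ : Measure (ℕ → ℝ)} {κ : Kernel ℝ ℝ} [IsMarkovKernel κ]
    {i j : ℕ} {A : Set ℕ} (h : Disintegrates μ κ i j A) {S : Set ℝ}
    (hSae : ∀ᵐ x ∂μ, x i ∈ S)
    (hS : ∀ u ∈ S, ∀ u' ∈ S, u ≤ u' → StochasticLE (κ u) (κ u')) :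
    Disintegrates (μ.map seqArctan) (monotoneExtension κ S) i j A := by
  intro F hF
  have hR : IsTest (resample (monotoneExtension κ S) i j F) univ :=
    hF.resample _ (subset_univ _) (mem_univ _)
  rw [integral_map measurable_seqArctan.aemeasurable hF.measurable.aestronglyMeasurable,
    integral_map measurable_seqArctan.aemeasurable hR.measurable.aestronglyMeasurable,
    h _ hF.comp_seqArctan]
  refine integral_congr_ae ?_
  filter_upwards [hSae] with x hx
  simp only [resample]
  rw [show seqArctan x i = Real.arctan (x i) from rfl, monotoneExtension_arctan hS hx,
    integral_map (f := fun z => F (Function.update (seqArctan x) j z))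
      Real.measurable_arctan.aemeasurable
      (hF.measurable.comp (measurable_update _)).aestronglyMeasurable]
  simp only [seqArctan_update]

/-- The monotone inverse of `arctan`, clamped to values in `[-K, K]`. -/
noncomputable def clampTan (K y : ℝ) : ℝ :=
  Real.tan (max (-Real.arctan K) (min (Real.arctan K) y))

lemma clampTan_arg_mem {K : ℝ} (hK : 0 ≤ K) (y : ℝ) :
    max (-Real.arctan K) (min (Real.arctan K) y) ∈ Ioo (-(Real.pi / 2)) (Real.pi / 2) := by
  have h1 := Real.arctan_lt_pi_div_two K
  have h2 : 0 ≤ Real.arctan K := by simpa using Real.arctan_strictMono.monotone hK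
  have h3 := Real.pi_pos
  exact ⟨lt_max_of_lt_left (by linarith), max_lt (by linarith) (min_lt_of_left_lt h1)⟩

lemma monotone_clampTan {K : ℝ} (hK : 0 ≤ K) : Monotone (clampTan K) := fun _ _ hxy =>
  Real.strictMonoOn_tan.monotoneOn (clampTan_arg_mem hK _) (clampTan_arg_mem hK _)
    (max_le_max le_rfl (min_le_min le_rfl hxy))

lemma clampTan_arctan (K x : ℝ) : clampTan K (Real.arctan x) = max (-K) (min K x) := by
  have hm := Real.arctan_strictMono.monotone
  rw [clampTan, ← Real.arctan_neg, ← hm.map_min, ← hm.map_max, Real.tan_arctan]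

lemma SeqSupermodular.comp_monotone {F : (ℕ → ℝ) → ℝ} (hF : SeqSupermodular F)
    {g : ℕ → ℝ → ℝ} (hg : ∀ i, Monotone (g i)) : SeqSupermodular fun x => F fun i => g i (x i) := by
  intro x y
  have h := hF (fun i => g i (x i)) (fun i => g i (y i))
  have h1 : ((fun i => g i (x i)) ⊓ fun i => g i (y i)) = fun i => g i ((x ⊓ y) i) := by
    ext i; exact ((hg i).map_inf _ _).symm
  have h2 : ((fun i => g i (x i)) ⊔ fun i => g i (y i)) = fun i => g i ((x ⊔ y) i) := by
    ext i; exact ((hg i).map_sup _ _).symm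
  rwa [h1, h2] at h

/-- Along coordinate `i` of `μ`, the kernel `κ` is almost surely stochastically increasing. -/
def AEStochIncreasing (μ : Measure (ℕ → ℝ)) (κ : Kernel ℝ ℝ) (i : ℕ) : Prop :=
  ∃ S : Set ℝ, (∀ᵐ u ∂μ.map (fun x => x i), u ∈ S) ∧ ∀ u ∈ S, ∀ u' ∈ S, u ≤ u' → StochasticLE (κ u) (κ u')

lemma measurable_pi_comp {g : ℝ → ℝ} (hg : Measurable g) :
    Measurable fun (x : ℕ → ℝ) (i : ℕ) => g (x i) :=
  measurable_pi_iff.2 fun i => hg.comp (measurable_pi_apply i)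

/-- The comparison is applied to the images under `arctan`. Since `tan` is not monotone on the line,
`F` is pulled back along `clampTan K`, which is; `hclamp` ensures that nothing is lost. -/
theorem comparison_of_aeStochIncreasing {μ ν : Measure (ℕ → ℝ)} {κ η : ℕ → Kernel ℝ ℝ}
    [∀ n, IsMarkovKernel (κ n)] [∀ n, IsMarkovKernel (η n)] {r : ℝ → ℝ → Prop}
    (hrefl : ∀ a, r a a) (htrans : ∀ a b c, r a b → r b c → r a c)
    (hκ : ∀ n, Disintegrates μ (κ n) n (n + 1) (Iic (n + 1)))
    (hη : ∀ n N, Disintegrates ν (η n) (n + 1) n (Icc n N))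
    (hκm : ∀ n, AEStochIncreasing μ (κ n) n) (hηm : ∀ n, AEStochIncreasing ν (η n) (n + 1))
    (hmarg : ∀ n F, IsTest F {n} → ∫ x, F x ∂μ = ∫ x, F x ∂ν)
    (hpair : ∀ n F, IsTest F {n, n + 1} → SeqSupermodular F → r (∫ x, F x ∂μ) (∫ x, F x ∂ν))
    {N : ℕ} {F : (ℕ → ℝ) → ℝ} (hF : IsTest F (Iic N)) (hs : SeqSupermodular F) {K : ℝ}
    (hK : 0 ≤ K) (hclamp : ∀ x : ℕ → ℝ, F (fun i => max (-K) (min K (x i))) = F x) :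
    r (∫ x, F x ∂μ) (∫ x, F x ∂ν) := by
  choose S hS hSm using hκm
  choose T hT hTm using hηm
  have hmono := monotone_clampTan hK
  have hF' : IsTest (fun y => F fun i => clampTan K (y i)) (Iic N) :=
    hF.comp (measurable_pi_comp hmono.measurable) fun x y i h => by simp [h]
  have hint : ∀ (ρ : Measure (ℕ → ℝ)) {G : (ℕ → ℝ) → ℝ} {A : Set ℕ}, IsTest G A →
      ∫ y, G y ∂ρ.map seqArctan = ∫ x, G (seqArctan x) ∂ρ := fun ρ G A hG =>
    integral_map measurable_seqArctan.aemeasurable hG.measurable.aestronglyMeasurable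
  have hback : ∀ ρ : Measure (ℕ → ℝ),
      ∫ y, F (fun i => clampTan K (y i)) ∂ρ.map seqArctan = ∫ x, F x ∂ρ := by
    intro ρ
    rw [hint ρ hF']
    simp only [seqArctan, clampTan_arctan, hclamp]
  rw [← hback μ, ← hback ν]
  refine comparison_of_stochMono (κ := fun n => monotoneExtension (κ n) (S n))
    (η := fun n => monotoneExtension (η n) (T n)) hrefl htrans
    (fun n => (hκ n).map_seqArctan (ae_of_ae_map (measurable_pi_apply _).aemeasurable (hS n)) (hSm n))
    (fun n N => (hη n N).map_seqArctan (ae_of_ae_map (measurable_pi_apply _).aemeasurable (hT n)) (hTm n))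
    (fun n => stochMono_monotoneExtension _ _) (fun n => stochMono_monotoneExtension _ _)
    ?_ ?_ hF' (hs.comp_monotone fun _ => hmono)
  · intro n G hG
    rw [hint μ hG, hint ν hG]
    exact hmarg n _ hG.comp_seqArctan
  · intro n G hG hGs
    rw [hint μ hG, hint ν hG]
    exact hpair n _ hG.comp_seqArctan
      (hGs.comp_monotone (g := fun _ => Real.arctan) fun _ => Real.arctan_strictMono.monotone)

/-! ### Disintegration of Markov laws. -/

section Markov

variable {Ω : Type*} [MeasurableSpace Ω] {P : Measure Ω} {X : ℕ → Ω → ℝ}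

lemma integral_processLaw (hX : ∀ i, Measurable (X i)) {F : (ℕ → ℝ) → ℝ} (hF : Measurable F) :
    ∫ x, F x ∂processLaw P X = ∫ ω, F (fun i => X i ω) ∂P :=
  integral_map (measurable_pi_iff.2 hX).aemeasurable hF.aestronglyMeasurable

variable [IsProbabilityMeasure P]

lemma isProbabilityMeasure_processLaw (hX : ∀ i, Measurable (X i)) :
    IsProbabilityMeasure (processLaw P X) :=
  Measure.isProbabilityMeasure_map (measurable_pi_iff.2 hX).aemeasurable

/-- `H` need only carry the coordinates that `F` sees besides `j`, and the conditioning coordinate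
`i`. It will be the past padded with zeros, or a constant sequence. -/
lemma disintegrates_of_map_eq (hX : ∀ i, Measurable (X i)) {H : Ω → ℕ → ℝ} (hH : Measurable H)
    {κ : Kernel ℝ ℝ} [IsMarkovKernel κ] {i j : ℕ} {A : Set ℕ}
    (hlaw : P.map (fun ω => (H ω, X j ω)) =
      (P.map H) ⊗ₘ κ.comap (fun x : ℕ → ℝ => x i) (measurable_pi_apply i))
    (hi : ∀ ω, H ω i = X i ω) (hA : ∀ k ∈ A, k ≠ j → ∀ ω, H ω k = X k ω) :
    Disintegrates (processLaw P X) κ i j A := by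
  intro F hF
  have hR : IsTest (resample κ i j F) univ := hF.resample _ (subset_univ _) (mem_univ _)
  have hm : Measurable fun p : (ℕ → ℝ) × ℝ => F (Function.update p.1 j p.2) :=
    hF.measurable.comp (measurable_update_pair j)
  obtain ⟨C, hC⟩ := hF.bounded
  have := Measure.isProbabilityMeasure_map (μ := P) hH.aemeasurable
  have hupd : ∀ ω z, F (Function.update (H ω) j z) = F (Function.update (fun i => X i ω) j z) := by
    intro ω z
    refine hF.dependsOn fun k hk => ?_
    by_cases h : k = j
    · subst h; simp
    · simp [Function.update_of_ne h, hA k hk h ω]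
  have h1 : ∫ ω, F (fun i => X i ω) ∂P =
      ∫ p, F (Function.update p.1 j p.2) ∂P.map (fun ω => (H ω, X j ω)) := by
    rw [integral_map (hH.prodMk (hX j)).aemeasurable hm.aestronglyMeasurable]
    congr 1
    ext ω
    simp only [hupd]
    rw [Function.update_eq_self_iff.2 rfl]
  rw [integral_processLaw hX hF.measurable, integral_processLaw hX hR.measurable, h1, hlaw,
    Measure.integral_compProd (Integrable.of_bound hm.aestronglyMeasurable C
      (ae_of_all _ fun p => hC _))]
  have h2 := integral_map (μ := P) hH.aemeasurable hR.measurable.aestronglyMeasurable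
  refine h2.trans ?_
  congr 1
  ext ω
  simp only [resample, hupd, hi]

/-- It suffices to test rectangles `s ×ˢ t`: since `H ⁻¹' s` lies in `m`, the defining property of
conditional expectation evaluates both sides. -/
lemma map_prodMk_eq_compProd_of_condExp {Ω : Type*} {m mΩ : MeasurableSpace Ω} {P : Measure Ω}
    [IsProbabilityMeasure P] (hm : m ≤ mΩ) {U V : Ω → ℝ} (hU : Measurable U) (hV : Measurable V)
    {H : Ω → ℕ → ℝ} (hHm : Measurable[m] H) {i : ℕ} (hi : ∀ ω, H ω i = U ω)
    (hM : ∀ B : Set ℝ, MeasurableSet B →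
      P⟦V ⁻¹' B | m⟧ =ᵐ[P] P⟦V ⁻¹' B | MeasurableSpace.comap U inferInstance⟧) :
    P.map (fun ω => (H ω, V ω)) =
      (P.map H) ⊗ₘ (condDistrib V U P).comap (fun x : ℕ → ℝ => x i) (measurable_pi_apply i) := by
  set κ := condDistrib V U P
  have hH : Measurable H := hHm.mono hm le_rfl
  have := Measure.isProbabilityMeasure_map (μ := P) hH.aemeasurable
  refine Measure.ext_prod fun {s t} hs ht => ?_
  have hsm : MeasurableSet[m] (H ⁻¹' s) := hHm hs
  have hkm : Measurable fun ω => κ (U ω) t := (κ.measurable_coe ht).comp hU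
  have hreal : ∫ ω in H ⁻¹' s, (κ (U ω)).real t ∂P = P.real (H ⁻¹' s ∩ V ⁻¹' t) := by
    have h1 : (fun ω => (κ (U ω)).real t) =ᵐ[P] P⟦V ⁻¹' t | m⟧ :=
      (condDistrib_ae_eq_condExp hU hV ht).trans (hM t ht).symm
    rw [setIntegral_congr_ae (g := P⟦V ⁻¹' t | m⟧) (hm _ hsm) (h1.mono fun ω h _ => h),
      setIntegral_condExp hm ((integrable_const _).indicator (hV ht)) hsm,
      integral_indicator_const _ (hV ht)]
    simp [measureReal_restrict_apply (hV ht), inter_comm]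
  rw [Measure.map_apply (hH.prodMk hV) (hs.prod ht), Measure.compProd_apply_prod hs ht,
    setLIntegral_map hs (Kernel.measurable_coe _ ht) hH]
  have hcomap : ∀ ω, (κ.comap (fun x : ℕ → ℝ => x i) (measurable_pi_apply i)) (H ω) t =
      κ (U ω) t := by
    intro ω; simp [Kernel.comap_apply, hi]
  simp only [hcomap]
  have hfin : ∫⁻ ω in H ⁻¹' s, κ (U ω) t ∂P ≠ ⊤ := by
    refine ((lintegral_mono fun ω => prob_le_one).trans_lt ?_).ne
    simp
  have hset : (fun ω => (H ω, V ω)) ⁻¹' s ×ˢ t = H ⁻¹' s ∩ V ⁻¹' t := rfl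
  rw [hset, ← ENNReal.toReal_eq_toReal_iff' (measure_ne_top _ _) hfin,
    ← integral_toReal hkm.aemeasurable (ae_of_all _ fun ω => measure_lt_top _ _)]
  exact hreal.symm

lemma measurable_past {Ω : Type*} {m : MeasurableSpace Ω} {X : ℕ → Ω → ℝ} {n : ℕ}
    (hX : ∀ j ≤ n, Measurable (X j)) :
    Measurable fun ω => (fun i => if i ≤ n then X i ω else 0 : ℕ → ℝ) := by
  refine measurable_pi_iff.2 fun i => ?_
  by_cases hi : i ≤ n
  · simpa only [hi, if_true] using hX i hi
  · simp only [hi, if_false]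
    exact measurable_const

lemma IsMarkovProcess.disintegrates (hX : IsMarkovProcess P X) (n : ℕ) :
    Disintegrates (processLaw P X) (condDistrib (X (n + 1)) (X n) P) n (n + 1) (Iic (n + 1)) := by
  have hm : ⨆ j ≤ n, MeasurableSpace.comap (X j) inferInstance ≤ ‹MeasurableSpace Ω› :=
    iSup₂_le fun j _ => (hX.1 j).comap_le
  have hpast := measurable_past (m := ⨆ j ≤ n, MeasurableSpace.comap (X j) inferInstance)
    (X := X) (n := n) fun j hj => Measurable.mono (comap_measurable (X j))
      (le_iSup₂ (f := fun j (_ : j ≤ n) => MeasurableSpace.comap (X j) inferInstance) j hj) le_rfl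
  refine disintegrates_of_map_eq hX.1 (hpast.mono hm le_rfl)
    (map_prodMk_eq_compProd_of_condExp hm (hX.1 n) (hX.1 (n + 1)) hpast (by simp)
      (hX.2 n)) (by simp) ?_
  · intro k hk hne ω
    have : k ≤ n := by
      simp only [mem_Iic] at hk; omega
    simp [this]

lemma disintegrates_condDistrib (hX : ∀ i, Measurable (X i)) (i j : ℕ) :
    Disintegrates (processLaw P X) (condDistrib (X j) (X i) P) i j {j, i} := by
  have hc : Measurable fun (u : ℝ) (_ : ℕ) => u := measurable_pi_iff.2 fun _ => measurable_id
  refine disintegrates_of_map_eq hX (H := fun ω _ => X i ω) (hc.comp (hX i)) ?_ (fun _ => rfl) ?_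
  · have := Measure.isProbabilityMeasure_map (μ := P) (hX i).aemeasurable
    have hmap : P.map (fun ω (_ : ℕ) => X i ω) = (P.map (X i)).map fun u _ => u :=
      (Measure.map_map hc (hX i)).symm
    have := Measure.isProbabilityMeasure_map (μ := P.map (X i)) hc.aemeasurable
    have h2 : P.map (fun ω => ((fun _ : ℕ => X i ω), X j ω)) =
        (P.map fun ω => (X i ω, X j ω)).map fun p => ((fun _ : ℕ => p.1), p.2) :=
      (Measure.map_map ((hc.comp measurable_fst).prodMk measurable_snd)
        ((hX i).prodMk (hX j))).symm
    rw [hmap, h2, ← compProd_map_condDistrib (hX j).aemeasurable]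
    refine Measure.ext_prod fun {s t} hs ht => ?_
    have hcm : Measurable fun p : ℝ × ℝ => ((fun _ : ℕ => p.1), p.2) :=
      (hc.comp measurable_fst).prodMk measurable_snd
    rw [Measure.map_apply hcm (hs.prod ht),
      Measure.compProd_apply_prod hs ht, setLIntegral_map hs (Kernel.measurable_coe _ ht) hc]
    exact Measure.compProd_apply_prod (hc hs) ht
  · intro k hk hne ω
    rcases hk with rfl | rfl
    · exact absurd rfl hne
    · rfl

lemma StochasticallyIncreasing.aeStochIncreasing (hX : ∀ i, Measurable (X i)) {i j : ℕ}
    (h : StochasticallyIncreasing P (X j) (X i)) :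
    AEStochIncreasing (processLaw P X) (condDistrib (X j) (X i) P) i := by
  obtain ⟨S, hS, hmono⟩ := h
  refine ⟨S, ?_, hmono⟩
  have : P.map (X i) = (processLaw P X).map fun x => x i :=
    (Measure.map_map (measurable_pi_apply i) (measurable_pi_iff.2 hX)).symm
  rwa [this] at hS

end Markov

/-! ### The independent sequence and domination of independent pairs. -/

section Independent

variable (q : ℕ → Measure ℝ) [∀ i, IsProbabilityMeasure (q i)]

/-- Refreshing one coordinate by an independent copy preserves a product measure; thus constant
kernels serve as its forward and backward transitions. -/
lemma infinitePi_eq_map_update (j : ℕ) :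
    ((Measure.infinitePi q).prod (q j)).map (fun p => Function.update p.1 j p.2) =
      Measure.infinitePi q := by
  refine Measure.eq_infinitePi _ fun s t ht => ?_
  rw [Measure.map_apply (measurable_update_pair j) (MeasurableSet.pi s.countable_toSet
    fun i _ => ht i)]
  have hpre : (fun p : (ℕ → ℝ) × ℝ => Function.update p.1 j p.2) ⁻¹' Set.pi s t =
      Set.pi (s.erase j) t ×ˢ (if j ∈ s then t j else univ) := by
    ext ⟨x, z⟩
    simp only [mem_preimage, Set.mem_pi, Finset.mem_coe, mem_prod, Finset.mem_erase]
    constructor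
    · intro h
      refine ⟨fun i hi => by simpa [Function.update_of_ne hi.1] using h i hi.2, ?_⟩
      split_ifs with hj
      · simpa using h j hj
      · exact mem_univ _
    · rintro ⟨h1, h2⟩ i hi
      by_cases hij : i = j
      · subst hij; simpa [hi] using h2
      · simpa [Function.update_of_ne hij] using h1 i ⟨hij, hi⟩
  rw [hpre, Measure.prod_prod, Measure.infinitePi_pi _ fun i _ => ht i]
  split_ifs with hj
  · rw [Finset.prod_erase_mul _ _ hj]
  · rw [Finset.erase_eq_of_notMem hj]; simp

lemma disintegrates_infinitePi (i j : ℕ) (A : Set ℕ) :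
    Disintegrates (Measure.infinitePi q) (Kernel.const ℝ (q j)) i j A := by
  intro F hF
  obtain ⟨C, hC⟩ := hF.bounded
  have hm : Measurable fun p : (ℕ → ℝ) × ℝ => F (Function.update p.1 j p.2) :=
    hF.measurable.comp (measurable_update_pair j)
  conv_lhs => rw [← infinitePi_eq_map_update q j]
  rw [integral_map (measurable_update_pair j).aemeasurable hF.measurable.aestronglyMeasurable,
    integral_prod _ (Integrable.of_bound hm.aestronglyMeasurable C (ae_of_all _ fun p => hC _))]
  rfl

lemma map_eval_infinitePi (i : ℕ) : (Measure.infinitePi q).map (fun x => x i) = q i := by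
  ext s hs
  rw [Measure.map_apply (measurable_pi_apply i) hs]
  have : (fun x : ℕ → ℝ => x i) ⁻¹' s = Set.pi ({i} : Finset ℕ) fun _ => s := by
    ext x; simp
  rw [this, Measure.infinitePi_pi _ fun _ _ => hs]
  simp

lemma aeStochIncreasing_const (μ : Measure (ℕ → ℝ)) (p : Measure ℝ) (i : ℕ) :
    AEStochIncreasing μ (Kernel.const ℝ p) i :=
  ⟨univ, ae_of_all _ fun _ => mem_univ _, fun _ _ _ _ _ _ _ _ _ => le_rfl⟩

end Independent

/-- Symmetrization: independent copies are dominated by the comonotone pair. -/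
lemma integral_integral_le_diagonal {p : Measure ℝ} [IsProbabilityMeasure p] {G : ℝ × ℝ → ℝ}
    (hG : Measurable G) {C : ℝ} (hC : ∀ z, |G z| ≤ C) {S : Set ℝ} (hS : ∀ᵐ u ∂p, u ∈ S)
    (h : ∀ u ∈ S, ∀ v ∈ S, G (u, v) + G (v, u) ≤ G (u, u) + G (v, v)) :
    ∫ u, ∫ v, G (u, v) ∂p ∂p ≤ ∫ u, G (u, u) ∂p := by
  have hI : ∀ T : ℝ × ℝ → ℝ × ℝ, Measurable T → Integrable (fun z => G (T z)) (p.prod p) :=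
    fun T hT => Integrable.of_bound (hG.comp hT).aestronglyMeasurable C (ae_of_all _ fun z => hC _)
  have h1 := hI id measurable_id
  have h2 := hI Prod.swap measurable_swap
  have h3 := hI (fun z => (z.1, z.1)) (measurable_fst.prodMk measurable_fst)
  have h4 := hI (fun z => (z.2, z.2)) (measurable_snd.prodMk measurable_snd)
  -- Integrated over two independent copies, each side of the symmetric inequality counts the
  -- desired quantity twice.
  have hle : ∫ z, (G (id z) + G z.swap) ∂p.prod p ≤
      ∫ z, (G (z.1, z.1) + G (z.2, z.2)) ∂p.prod p := by
    refine integral_mono_ae (h1.add h2) (h3.add h4) ?_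
    have e1 : ∀ᵐ z ∂p.prod p, z.1 ∈ S := Measure.quasiMeasurePreserving_fst.ae hS
    have e2 : ∀ᵐ z ∂p.prod p, z.2 ∈ S := Measure.quasiMeasurePreserving_snd.ae hS
    filter_upwards [e1, e2] with z hz1 hz2
    exact h z.1 hz1 z.2 hz2
  rw [integral_add h1 h2, integral_add h3 h4, integral_prod_swap (fun z => G z),
    integral_fun_fst (fun u => G (u, u)), integral_fun_snd (fun u => G (u, u))] at hle
  simp only [id, probReal_univ, one_smul] at hle
  rw [integral_prod G h1] at hle
  linarith

/-- A pair whose second entry is stochastically increasing in the first dominates its independent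
version in the supermodular order. -/
lemma integral_independent_le_of_aeStochIncreasing {μ : Measure (ℕ → ℝ)} [IsProbabilityMeasure μ]
    {κ : Kernel ℝ ℝ} [IsMarkovKernel κ] {i j : ℕ} (hij : i ≠ j)
    (hD : Disintegrates μ κ i j {i, j}) (hκ : AEStochIncreasing μ κ i)
    {F : (ℕ → ℝ) → ℝ} (hF : IsTest F {i, j}) (hs : SeqSupermodular F)
    (q : ℕ → Measure ℝ) [∀ n, IsProbabilityMeasure (q n)] (hq : ∀ n, μ.map (fun x => x n) = q n) :
    ∫ x, F x ∂Measure.infinitePi q ≤ ∫ x, F x ∂μ := by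
  obtain ⟨S, hS, hmono⟩ := hκ
  obtain ⟨C, hC⟩ := hF.bounded
  have hmi : Measurable fun u : ℝ => Function.update (0 : ℕ → ℝ) i u := measurable_update _
  have hdep : ∀ (x : ℕ → ℝ) z, F (Function.update x j z) =
      F (Function.update (Function.update 0 i (x i)) j z) := by
    intro x z
    refine hF.dependsOn fun k hk => ?_
    rcases hk with rfl | rfl
    · simp [Function.update_of_ne hij]
    · simp
  have hφm : Measurable fun p : ℝ × ℝ => F (Function.update (Function.update 0 i p.1) j p.2) :=
    hF.measurable.comp ((measurable_update_pair j).comp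
      ((hmi.comp measurable_fst).prodMk measurable_snd))
  -- The value `u` of the first entry is separated from the value `v` that selects the conditional
  -- law: the diagonal gives `μ`, independent arguments give the product law.
  set G : ℝ × ℝ → ℝ := fun p => ∫ z, F (Function.update (Function.update 0 i p.1) j z) ∂κ p.2
    with hG_def
  have hGm : Measurable G := by
    have h : StronglyMeasurable fun p : (ℝ × ℝ) × ℝ =>
        F (Function.update (Function.update 0 i p.1.1) j p.2) :=
      (hφm.comp ((measurable_fst.comp measurable_fst).prodMk measurable_snd)).stronglyMeasurable
    exact (h.integral_kernel_prod_right' (κ := κ.comap Prod.snd measurable_snd)).measurable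
  have hGC : ∀ p, |G p| ≤ C := fun p => by
    have := norm_integral_le_of_norm_le_const (μ := κ p.2) (C := C)
      (f := fun z => F (Function.update (Function.update 0 i p.1) j z)) (ae_of_all _ fun z => hC _)
    simpa using this
  have hint : ∀ (u : ℝ) (p : Measure ℝ) [IsFiniteMeasure p],
      Integrable (fun z => F (Function.update (Function.update 0 i u) j z)) p :=
    fun u p _ => hF.integrable_update _ _ _
  have hGS : ∀ u ∈ S, ∀ v ∈ S, G (u, v) + G (v, u) ≤ G (u, u) + G (v, v) := by
    have main : ∀ u ∈ S, ∀ v ∈ S, u ≤ v → G (u, v) + G (v, u) ≤ G (u, u) + G (v, v) := by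
      intro u hu v hv huv
      have hle : Function.update (0 : ℕ → ℝ) i u ≤ Function.update (0 : ℕ → ℝ) i v :=
        update_le_update_iff.2 ⟨huv, fun _ _ => le_rfl⟩
      have h := hmono u hu v hv huv _ (hs.monotone_sub hle j) ((hint _ _).sub (hint _ _))
        ((hint _ _).sub (hint _ _))
      rw [integral_sub (hint _ _) (hint _ _), integral_sub (hint _ _) (hint _ _)] at h
      simp only [hG_def]
      linarith
    intro u hu v hv
    rcases le_total u v with h | h
    · exact main u hu v hv h
    · linarith [main v hv u hu h]
  rw [hq i] at hS
  have hdiag := integral_integral_le_diagonal hGm hGC hS hGS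
  have hright : ∫ x, F x ∂μ = ∫ u, G (u, u) ∂q i := by
    rw [hD F hF, ← hq i, integral_map (measurable_pi_apply i).aemeasurable
      (hGm.comp (measurable_id.prodMk measurable_id)).aestronglyMeasurable]
    exact integral_congr_ae (ae_of_all _ fun x => integral_congr_ae (ae_of_all _ (hdep x)))
  -- Averaging the conditional law over the law of coordinate `i` returns the marginal of coordinate
  -- `j`.
  have hinner : ∀ u, ∫ v, G (u, v) ∂q i =
      ∫ z, F (Function.update (Function.update 0 i u) j z) ∂q j := by
    intro u
    have hT : IsTest (fun x => F (Function.update (Function.update 0 i u) j (x j))) {i, j} := by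
      refine ⟨(hφm.comp (measurable_const.prodMk measurable_id)).comp (measurable_pi_apply j),
        ⟨C, fun x => hC _⟩, fun x y h => ?_⟩
      simp only [h j (by simp)]
    have h := hD _ hT
    rw [← hq j, ← hq i, integral_map (measurable_pi_apply i).aemeasurable
      (hGm.comp (measurable_const.prodMk measurable_id)).aestronglyMeasurable,
      integral_map (measurable_pi_apply j).aemeasurable
      (hφm.comp (measurable_const.prodMk measurable_id)).aestronglyMeasurable]
    simpa [resample] using h.symm
  have hleft : ∫ x, F x ∂Measure.infinitePi q =
      ∫ u, ∫ z, F (Function.update (Function.update 0 i u) j z) ∂q j ∂q i := by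
    rw [disintegrates_infinitePi q i j _ F hF, ← map_eval_infinitePi q i,
      integral_map (measurable_pi_apply i).aemeasurable]
    · exact integral_congr_ae (ae_of_all _ fun x => integral_congr_ae (ae_of_all _ (hdep x)))
    · exact (hφm.stronglyMeasurable.integral_prod_right' (ν := q j)).aestronglyMeasurable
  rw [hleft, hright]
  simpa only [hinner] using hdiag

/-! ### From bounded clamped functions to weighted ones. -/

/-- Clamping of a real number to `[a, b]`. -/
noncomputable def clamp (a b x : ℝ) : ℝ := max a (min b x)

lemma monotone_clamp (a b : ℝ) : Monotone (clamp a b) := fun _ _ h =>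
  max_le_max le_rfl (min_le_min le_rfl h)

lemma measurable_clamp (a b : ℝ) : Measurable (clamp a b) := (monotone_clamp a b).measurable

lemma clamp_of_mem {a b x : ℝ} (h1 : a ≤ x) (h2 : x ≤ b) : clamp a b x = x := by
  simp [clamp, h1, h2]

lemma le_clamp (a b x : ℝ) : a ≤ clamp a b x := le_max_left _ _

lemma clamp_le {a b : ℝ} (h : a ≤ b) (x : ℝ) : clamp a b x ≤ b := max_le h (min_le_left _ _)

lemma clamp_clamp {a b K : ℝ} (hab : a ≤ b) (ha : -K ≤ a) (hb : b ≤ K) (x : ℝ) :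
    clamp a b (max (-K) (min K x)) = clamp a b x := by
  simp only [clamp]
  rcases le_total x (-K) with h1 | h1
  · rw [min_eq_right (by linarith : x ≤ K), max_eq_left h1, min_eq_right (by linarith : -K ≤ b),
      min_eq_right (by linarith : x ≤ b), max_eq_left ha, max_eq_left (by linarith : x ≤ a)]
  · rcases le_total x K with h2 | h2
    · rw [min_eq_right h2, max_eq_right h1]
    · rw [min_eq_left h2, max_eq_right (by linarith : -K ≤ K), min_eq_left hb,
        min_eq_left (by linarith : b ≤ x)]

/-- The infimum of `β` over `[B, ∞)` is at least `1`, so some point attains less than twice it. No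
monotonicity of `β` is needed. -/
lemma exists_ge_near_minimizer {β : ℝ → ℝ} (hβ : ∀ x, 1 ≤ β x) (B : ℝ) :
    ∃ b ≥ B, ∀ y ≥ b, β b ≤ 2 * β y := by
  have hbdd : BddBelow (β '' Ici B) := ⟨1, by rintro _ ⟨x, -, rfl⟩; exact hβ x⟩
  have hne : (β '' Ici B).Nonempty := ⟨_, B, self_mem_Ici, rfl⟩
  have h1 : 1 ≤ sInf (β '' Ici B) := le_csInf hne (by rintro _ ⟨x, -, rfl⟩; exact hβ x)
  obtain ⟨_, ⟨b, hb, rfl⟩, hlt⟩ :=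
    exists_lt_of_csInf_lt hne (by linarith : sInf (β '' Ici B) < 2 * sInf (β '' Ici B))
  refine ⟨b, hb, fun y hy => hlt.le.trans ?_⟩
  have := csInf_le hbdd ⟨y, le_trans hb hy, rfl⟩
  linarith

/-- Arbitrarily large intervals such that clamping to them increases `β` at most by a factor. -/
lemma exists_clamp_le {β : ℝ → ℝ} (hβ : ∀ x, 1 ≤ β x) {B : ℝ} (hB : 0 ≤ B) :
    ∃ a ≤ -B, ∃ b ≥ B, a ≤ b ∧ ∀ x, β (clamp a b x) ≤ 2 * β x := by
  obtain ⟨b, hb, hb2⟩ := exists_ge_near_minimizer hβ B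
  obtain ⟨a, ha, ha2⟩ := exists_ge_near_minimizer (β := fun x => β (-x)) (fun x => hβ _) B
  have hab : -a ≤ b := by linarith
  refine ⟨-a, by linarith, b, hb, hab, fun x => ?_⟩
  rcases le_total x (-a) with h1 | h1
  · have : clamp (-a) b x = -a := max_eq_left ((min_le_right _ _).trans h1)
    rw [this]
    simpa using ha2 (-x) (by linarith)
  · rcases le_total x b with h2 | h2
    · rw [clamp_of_mem h1 h2]; linarith [hβ x]
    · have : clamp (-a) b x = b := by simp [clamp, h2, hab]
      rw [this]
      exact hb2 x h2

lemma Supermodular.comp_monotone {d : ℕ} {f : (Fin d → ℝ) → ℝ} (hf : Supermodular f)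
    {g : Fin d → ℝ → ℝ} (hg : ∀ i, Monotone (g i)) : Supermodular fun x => f fun i => g i (x i) := by
  intro x y
  have h := hf (fun i => g i (x i)) (fun i => g i (y i))
  have h1 : ((fun i => g i (x i)) ⊓ fun i => g i (y i)) = fun i => g i ((x ⊓ y) i) := by
    ext i; exact ((hg i).map_inf _ _).symm
  have h2 : ((fun i => g i (x i)) ⊔ fun i => g i (y i)) = fun i => g i ((x ⊔ y) i) := by
    ext i; exact ((hg i).map_sup _ _).symm
  rwa [h1, h2] at h

/-- Increments of a supermodular function dominate the sum of the increments along the axes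
through a lower point. -/
lemma Supermodular.sum_sub_le {d : ℕ} {f : (Fin d → ℝ) → ℝ} (hf : Supermodular f)
    {a x y : Fin d → ℝ} (hax : a ≤ x) (hxy : x ≤ y) :
    ∑ k, (f (Function.update a k (y k)) - f (Function.update a k (x k))) ≤ f y - f x := by
  have main : ∀ s : Finset (Fin d),
      ∑ k ∈ s, (f (Function.update a k (y k)) - f (Function.update a k (x k))) ≤
        f (s.piecewise y x) - f x := by
    intro s
    induction s using Finset.induction_on with
    | empty => simp
    | insert k s hk ih =>
      rw [Finset.sum_insert hk, Finset.piecewise_insert]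
      -- The meet is the axis point with entry `x k`; the join raises coordinate `k` of the
      -- piecewise point from `x k` to `y k`.
      have h := hf (Function.update a k (y k)) (s.piecewise y x)
      have h1 : Function.update a k (y k) ⊓ s.piecewise y x = Function.update a k (x k) := by
        ext l
        by_cases hl : l = k
        · subst hl; simp [hk, hxy l]
        · by_cases hls : l ∈ s
          · simp [Function.update_of_ne hl, hls, (hax l).trans (hxy l)]
          · simp [Function.update_of_ne hl, hls, hax l]
      have h2 : Function.update a k (y k) ⊔ s.piecewise y x =
          Function.update (s.piecewise y x) k (y k) := by
        ext l
        by_cases hl : l = k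
        · subst hl; simp [hk, hxy l]
        · by_cases hls : l ∈ s
          · simp [Function.update_of_ne hl, hls, (hax l).trans (hxy l)]
          · simp [Function.update_of_ne hl, hls, hax l]
      rw [h1, h2] at h
      linarith
  simpa using main Finset.univ

section Extension

variable {μ ν : Measure (ℕ → ℝ)} [IsProbabilityMeasure μ] [IsProbabilityMeasure ν]

/-- `μ` is below `ν` on bounded supermodular functions of finitely many clamped coordinates. -/
def ClampedLE (μ ν : Measure (ℕ → ℝ)) : Prop :=
  ∀ (N : ℕ) (F : (ℕ → ℝ) → ℝ) (K : ℝ), IsTest F (Iic N) → SeqSupermodular F → 0 ≤ K →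
    (∀ x : ℕ → ℝ, F (fun i => max (-K) (min K (x i))) = F x) → ∫ x, F x ∂μ ≤ ∫ x, F x ∂ν

/-- Clamping alone does not bound `f`, which may be locally unbounded. Subtracting its restrictions
to the axes through `lo` does: by `Supermodular.sum_sub_le` the remainder lies between constants.
The subtracted terms are modular and have equal integrals under both laws. -/
lemma ClampedLE.integral_clamp_le (h : ClampedLE μ ν)
    (hmarg : ∀ i, μ.map (fun x => x i) = ν.map (fun x => x i)) {m : ℕ} (n : Fin m → ℕ)
    {f : (Fin m → ℝ) → ℝ} (hfm : Measurable f) (hf : Supermodular f)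
    {lo hi : Fin m → ℝ} (hlh : lo ≤ hi)
    (hint : ∀ k, Integrable (fun v => f (Function.update lo k (clamp (lo k) (hi k) v)))
      (μ.map fun x => x (n k))) :
    ∫ x, f (fun k => clamp (lo k) (hi k) (x (n k))) ∂μ ≤
      ∫ x, f (fun k => clamp (lo k) (hi k) (x (n k))) ∂ν := by
  set g : Fin m → ℝ → ℝ := fun k v => f (Function.update lo k (clamp (lo k) (hi k) v)) with hg
  set T : (ℕ → ℝ) → Fin m → ℝ := fun x k => clamp (lo k) (hi k) (x (n k)) with hT
  set F : (ℕ → ℝ) → ℝ := fun x => f (T x) - ∑ k, (g k (x (n k)) - f lo) with hF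
  have hTm : Measurable T := measurable_pi_iff.2 fun k =>
    (measurable_clamp _ _).comp (measurable_pi_apply _)
  have hgm : ∀ k, Measurable (g k) := fun k =>
    hfm.comp ((measurable_update lo).comp (measurable_clamp _ _))
  have hloT : ∀ x, lo ≤ T x := fun x k => le_clamp _ _ _
  have hThi : ∀ x, T x ≤ hi := fun x k => clamp_le (hlh k) _
  have hFm : Measurable F := (hfm.comp hTm).sub (Finset.measurable_fun_sum _ fun k _ =>
    ((hgm k).comp (measurable_pi_apply (n k))).sub_const _)
  have hFlow : ∀ x, f lo ≤ F x := by
    intro x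
    have := hf.sum_sub_le le_rfl (hloT x)
    simp only [Function.update_eq_self] at this
    simp only [hF, hg]
    linarith
  have hFup : ∀ x, F x ≤ f hi - ∑ k, (f (Function.update lo k (hi k)) - f lo) := by
    intro x
    have := hf.sum_sub_le (hloT x) (hThi x)
    simp only [hF, hg, Finset.sum_sub_distrib] at this ⊢
    linarith
  have hFtest : IsTest F (Iic (Finset.univ.sup n)) := by
    refine ⟨hFm, ⟨|f lo| + |f hi - ∑ k, (f (Function.update lo k (hi k)) - f lo)|, fun x => ?_⟩, ?_⟩
    · rw [abs_le]
      constructor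
      · linarith [hFlow x, neg_abs_le (f lo),
          abs_nonneg (f hi - ∑ k, (f (Function.update lo k (hi k)) - f lo))]
      · linarith [hFup x, le_abs_self (f hi - ∑ k, (f (Function.update lo k (hi k)) - f lo)),
          abs_nonneg (f lo)]
    · intro x y hxy
      have : ∀ k, x (n k) = y (n k) := fun k => 
        hxy _ (mem_Iic.2 (Finset.le_sup (Finset.mem_univ k)))
      simp only [hF, hT, this]
  have hFs : SeqSupermodular F := by
    intro x y
    have h1 := hf.comp_monotone (fun k => monotone_clamp (lo k) (hi k))
      (fun k => x (n k)) (fun k => y (n k))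
    have h2 : ∀ k, g k ((x ⊓ y) (n k)) + g k ((x ⊔ y) (n k)) = g k (x (n k)) + g k (y (n k)) := by
      intro k
      rcases le_total (x (n k)) (y (n k)) with h | h
      · simp [h]
      · simp [h, add_comm]
    have h3 := Finset.sum_congr rfl fun k (_ : k ∈ Finset.univ) => h2 k
    simp only [Finset.sum_add_distrib] at h3
    simp only [hF, hT, Finset.sum_sub_distrib, Pi.inf_apply, Pi.sup_apply] at h1 h3 ⊢
    linarith
  -- This level exceeds every endpoint in absolute value, so the outer clamping is invisible.
  have hle := h _ F (∑ k, (|lo k| + |hi k|)) hFtest hFs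
    (Finset.sum_nonneg fun k _ => by positivity) (by
      intro x
      have hk : ∀ k, clamp (lo k) (hi k) (max (-∑ k, (|lo k| + |hi k|))
          (min (∑ k, (|lo k| + |hi k|)) (x (n k)))) = clamp (lo k) (hi k) (x (n k)) := by
        intro k
        have hs : |lo k| + |hi k| ≤ ∑ k, (|lo k| + |hi k|) :=
          Finset.single_le_sum (f := fun k => |lo k| + |hi k|) (fun l _ => by positivity)
            (Finset.mem_univ k)
        refine clamp_clamp (hlh k) ?_ ?_ _
        · linarith [neg_abs_le (lo k), abs_nonneg (hi k)]
        · linarith [le_abs_self (hi k), abs_nonneg (lo k)]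
      simp only [hF, hT, hg, hk])
  have hsplit : ∀ ρ : Measure (ℕ → ℝ), IsProbabilityMeasure ρ →
      (∀ k, Integrable (g k) (ρ.map fun x => x (n k))) →
      ∫ x, f (T x) ∂ρ = ∫ x, F x ∂ρ + ∑ k, (∫ v, g k v ∂(ρ.map fun x => x (n k)) - f lo) := by
    intro ρ _ hi
    have hi' : ∀ k, Integrable (fun x : ℕ → ℝ => g k (x (n k))) ρ := fun k =>
      (hi k).comp_measurable (measurable_pi_apply (n k))
    have e : ∀ x, f (T x) = F x + ∑ k, (g k (x (n k)) - f lo) := fun x => by simp [hF]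
    simp only [e]
    have hi2 : ∀ k, Integrable (fun x : ℕ → ℝ => g k (x (n k)) - f lo) ρ := fun k =>
      (hi' k).sub (integrable_const _)
    rw [integral_add (hFtest.integrable ρ) (integrable_finsetSum _ fun k _ => hi2 k),
      integral_finsetSum _ fun k _ => hi2 k]
    congr 1
    refine Finset.sum_congr rfl fun k _ => ?_
    rw [integral_sub (hi' k) (integrable_const _), integral_map
      (measurable_pi_apply (n k)).aemeasurable (hgm k).aestronglyMeasurable]
    simp
  rw [hsplit μ inferInstance hint, hsplit ν inferInstance fun k => by rw [← hmarg]; exact hint k]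
  simp only [hmarg]
  linarith

/-- Dominated convergence along growing clamping intervals, chosen so that clamping at most doubles
each `β k`; this supplies the integrable majorant. -/
lemma ClampedLE.integral_le (h : ClampedLE μ ν)
    (hmarg : ∀ i, μ.map (fun x => x i) = ν.map (fun x => x i)) {m : ℕ} (n : Fin m → ℕ)
    {f : (Fin m → ℝ) → ℝ} (hfm : Measurable f) (hf : Supermodular f)
    {β : Fin m → ℝ → ℝ} (hβ : ∀ k x, 1 ≤ β k x)
    (hβi : ∀ k, Integrable (β k) (μ.map fun x => x (n k)))
    {D : ℝ} (hD : 0 ≤ D) (hbound : ∀ x, |f x| ≤ D * (1 + ∑ k, β k (x k))) :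
    ∫ x, f (fun k => x (n k)) ∂μ ≤ ∫ x, f (fun k => x (n k)) ∂ν := by
  choose lo hlo hi hhi hlh hcl using fun (N : ℕ) (k : Fin m) =>
    exists_clamp_le (hβ k) (Nat.cast_nonneg (α := ℝ) N)
  have hdom : ∀ N (x : Fin m → ℝ), |f fun k => clamp (lo N k) (hi N k) (x k)| ≤
      D * (1 + ∑ k, 2 * β k (x k)) := by
    intro N x
    refine (hbound _).trans (mul_le_mul_of_nonneg_left ?_ hD)
    gcongr with k
    exact hcl N k _
  have hlim : ∀ ρ : Measure (ℕ → ℝ), IsProbabilityMeasure ρ →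
      (∀ k, Integrable (β k) (ρ.map fun x => x (n k))) →
      Tendsto (fun N => ∫ x, f (fun k => clamp (lo N k) (hi N k) (x (n k))) ∂ρ) atTop
        (𝓝 (∫ x, f (fun k => x (n k)) ∂ρ)) := by
    intro ρ _ hρ
    refine tendsto_integral_of_dominated_convergence
      (fun x => D * (1 + ∑ k, 2 * β k (x (n k)))) (fun N => ?_) ?_
      (fun N => ae_of_all _ fun x => hdom N _) (ae_of_all _ fun x => ?_)
    · exact (hfm.comp (measurable_pi_iff.2 fun k =>
        (measurable_clamp _ _).comp (measurable_pi_apply _))).aestronglyMeasurable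
    · refine ((integrable_const _).add (integrable_finsetSum _ fun k _ => ?_)).const_mul D
      exact ((hρ k).comp_measurable (measurable_pi_apply (n k))).const_mul 2
    -- For fixed `x` the clamping is eventually the identity, so `f` need not be continuous.
    · refine tendsto_const_nhds.congr' ?_
      filter_upwards [eventually_ge_atTop ⌈∑ k, |x (n k)|⌉₊] with N hN
      congr 1
      ext k
      have h1 : |x (n k)| ≤ N := (Finset.single_le_sum (f := fun k => |x (n k)|)
        (fun l _ => abs_nonneg _) (Finset.mem_univ k)).trans (Nat.ceil_le.1 hN)
      rw [abs_le] at h1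
      exact (clamp_of_mem ((hlo N k).trans h1.1) (h1.2.trans (hhi N k))).symm
  refine le_of_tendsto_of_tendsto' (hlim μ inferInstance hβi)
    (hlim ν inferInstance fun k => by rw [← hmarg]; exact hβi k) fun N => ?_
  refine h.integral_clamp_le hmarg n hfm hf (hlh N) fun k => ?_
  -- Along an axis through `lo N` the other entries are frozen, so the majorant is a constant plus a
  -- multiple of `β k`.
  refine Integrable.mono' (g := fun v => D * (1 + (∑ l, β l (lo N l) + 2 * β k v))) ?_
    (hfm.comp ((measurable_update _).comp (measurable_clamp _ _))).aestronglyMeasurable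
    (ae_of_all _ fun v => ?_)
  · exact ((integrable_const _).add ((integrable_const _).add ((hβi k).const_mul 2))).const_mul D
  · refine (hbound _).trans (mul_le_mul_of_nonneg_left ?_ hD)
    gcongr
    rw [← Finset.add_sum_erase _ _ (Finset.mem_univ k), Function.update_self, add_comm]
    refine add_le_add ?_ (hcl N k v)
    refine (Finset.sum_le_sum fun l hl => ?_).trans
      (Finset.sum_le_sum_of_subset_of_nonneg (Finset.erase_subset k _) fun l _ _ => ?_)
    · rw [Function.update_of_ne (Finset.ne_of_mem_erase hl)]
    · linarith [hβ l (lo N l)]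

lemma ClampedLE.processSupermodularLE (h : ClampedLE μ ν)
    (hmarg : ∀ i, μ.map (fun x => x i) = ν.map (fun x => x i))
    {b : (d : ℕ) → (Fin d → ℝ) → ℝ} (hb : ∀ d, IsWeight (b d))
    (hβ : ∀ (m : ℕ) (n : Fin m → ℕ), ∃ (c : ℝ) (β : Fin m → ℝ → ℝ),
      (∀ k, Integrable (β k) (μ.map fun x => x (n k))) ∧ ∀ x, b m x ≤ c + ∑ k, β k (x k)) :
    ProcessSupermodularLE b μ ν := by
  intro m n
  obtain ⟨c, β, hβi, hbβ⟩ := hβ m n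
  have hn : Measurable fun (x : ℕ → ℝ) (k : Fin m) => x (n k) :=
    measurable_pi_iff.2 fun k => measurable_pi_apply _
  have hbi : ∀ ρ : Measure (ℕ → ℝ), IsProbabilityMeasure ρ →
      (∀ k, Integrable (β k) (ρ.map fun x => x (n k))) →
      Integrable (b m) (ρ.map fun x k => x (n k)) := by
    intro ρ _ hρ
    rw [integrable_map_measure (hb m).1.aestronglyMeasurable hn.aemeasurable]
    refine Integrable.mono' (g := fun x => c + ∑ k, β k (x (n k))) ?_
      ((hb m).1.comp hn).aestronglyMeasurable (ae_of_all _ fun x => ?_)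
    · exact (integrable_const _).add (integrable_finsetSum _ fun k _ =>
        (hρ k).comp_measurable (measurable_pi_apply (n k)))
    · rw [Real.norm_eq_abs, Function.comp_apply,
        abs_of_nonneg (by linarith [(hb m).2 fun k => x (n k)])]
      exact hbβ _
  refine ⟨hbi μ inferInstance hβi, hbi ν inferInstance fun k => by rw [← hmarg]; exact hβi k, ?_⟩
  rintro f hfm hf ⟨C, hC⟩
  rw [integral_map hn.aemeasurable hfm.aestronglyMeasurable,
    integral_map hn.aemeasurable hfm.aestronglyMeasurable]
  refine h.integral_le hmarg n hfm hf (β := fun k x => 1 + |β k x|)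
    (fun k x => by linarith [abs_nonneg (β k x)])
    (fun k => (integrable_const _).add (hβi k).abs) (D := |C| * (1 + |c|)) (by positivity)
    fun x => (hC x).trans ?_
  have hb0 : 0 ≤ b m x := by linarith [(hb m).2 x]
  have hS : ∑ k, β k (x k) ≤ ∑ k, (1 + |β k (x k)|) :=
    Finset.sum_le_sum fun k _ => by linarith [le_abs_self (β k (x k))]
  have hS0 : 0 ≤ ∑ k, (1 + |β k (x k)|) := Finset.sum_nonneg fun k _ => by positivity
  have h1 : b m x ≤ (1 + |c|) * (1 + ∑ k, (1 + |β k (x k)|)) := by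
    have := mul_nonneg (abs_nonneg c) hS0
    linarith [hbβ x, le_abs_self c]
  calc C * b m x ≤ |C| * b m x := mul_le_mul_of_nonneg_right (le_abs_self C) hb0
    _ ≤ |C| * ((1 + |c|) * (1 + ∑ k, (1 + |β k (x k)|))) :=
      mul_le_mul_of_nonneg_left h1 (abs_nonneg C)
    _ = _ := by ring

end Extension

/-! ### Consequences of the ordering of consecutive pairs. -/

lemma map_eval_processLaw {Ω : Type*} [MeasurableSpace Ω] {P : Measure Ω} {X : ℕ → Ω → ℝ}
    (hX : ∀ i, Measurable (X i)) (i : ℕ) : (processLaw P X).map (fun x => x i) = P.map (X i) :=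
  Measure.map_map (measurable_pi_apply i) (measurable_pi_iff.2 hX)

lemma integral_eq_of_map_eval_eq {μ ν : Measure (ℕ → ℝ)} {i : ℕ}
    (h : μ.map (fun x => x i) = ν.map (fun x => x i)) {F : (ℕ → ℝ) → ℝ} (hF : IsTest F {i}) :
    ∫ x, F x ∂μ = ∫ x, F x ∂ν := by
  have hc : Measurable fun (u : ℝ) (_ : ℕ) => u := measurable_pi_iff.2 fun _ => measurable_id
  have key : ∀ ρ : Measure (ℕ → ℝ), ∫ x, F x ∂ρ = ∫ u, F (fun _ => u) ∂ρ.map (fun x => x i) := by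
    intro ρ
    rw [integral_map (measurable_pi_apply i).aemeasurable
      (hF.measurable.comp hc).aestronglyMeasurable]
    congr 1
    ext x
    refine hF.dependsOn fun k hk => ?_
    rw [mem_singleton_iff.1 hk]
  rw [key μ, key ν, h]

section Consecutive

variable {Ω Ω' : Type*} [MeasurableSpace Ω] [MeasurableSpace Ω'] {P : Measure Ω} {Q : Measure Ω'}
  {X : ℕ → Ω → ℝ} {Y : ℕ → Ω' → ℝ} {b : (Fin 2 → ℝ) → ℝ}

lemma measurable_consecutive (hX : ∀ i, Measurable (X i)) (n : ℕ) :
    Measurable fun ω => ![X n ω, X (n + 1) ω] := by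
  refine measurable_pi_iff.2 fun k => ?_
  fin_cases k
  · simpa using hX n
  · simpa using hX (n + 1)

lemma SupermodularLE.integral_le_of_bounded {d : ℕ} {b : (Fin d → ℝ) → ℝ} (hb : IsWeight b)
    {μ ν : Measure (Fin d → ℝ)} (h : SupermodularLE b μ ν) {f : (Fin d → ℝ) → ℝ}
    (hfm : Measurable f) (hf : Supermodular f) {C : ℝ} (hC : ∀ x, |f x| ≤ C) :
    ∫ x, f x ∂μ ≤ ∫ x, f x ∂ν :=
  h.2.2 f hfm hf ⟨C, fun x => (hC x).trans
    (le_mul_of_one_le_right ((abs_nonneg _).trans (hC x)) (hb.2 x))⟩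

lemma SupermodularLE.integral_test_le (hb : IsWeight b) (hX : ∀ i, Measurable (X i))
    (hY : ∀ i, Measurable (Y i)) {n : ℕ}
    (h : SupermodularLE b (consecutiveLaw P X n) (consecutiveLaw Q Y n))
    {F : (ℕ → ℝ) → ℝ} (hF : IsTest F {n, n + 1}) (hs : SeqSupermodular F) :
    ∫ x, F x ∂processLaw P X ≤ ∫ x, F x ∂processLaw Q Y := by
  obtain ⟨C, hC⟩ := hF.bounded
  -- Coordinates other than `n` and `n + 1` are filled with `v 0`; the test function does not see
  -- them.
  have he : Measurable fun (v : Fin 2 → ℝ) (k : ℕ) => if k = n + 1 then v 1 else v 0 := by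
    refine measurable_pi_iff.2 fun k => ?_
    by_cases hk : k = n + 1
    · simpa [hk] using measurable_pi_apply 1
    · simpa [hk] using measurable_pi_apply 0
  have hfm := hF.measurable.comp he
  have hdep : ∀ x : ℕ → ℝ,
      F (fun k => if k = n + 1 then ![x n, x (n + 1)] 1 else ![x n, x (n + 1)] 0) = F x := by
    intro x
    refine hF.dependsOn fun k hk => ?_
    rcases hk with rfl | rfl
    · simp
    · simp
  have hsm : Supermodular fun v : Fin 2 → ℝ => F fun k => if k = n + 1 then v 1 else v 0 := by
    intro x y
    have hxy := hs (fun k => if k = n + 1 then x 1 else x 0) fun k => if k = n + 1 then y 1 else y 0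
    convert hxy using 3
    · ext k; by_cases hk : k = n + 1 <;> simp [hk]
    · ext k; by_cases hk : k = n + 1 <;> simp [hk]
  have h1 := h.integral_le_of_bounded hb hfm hsm (C := C) fun v => hC _
  rw [consecutiveLaw, consecutiveLaw,
    integral_map (measurable_consecutive hX n).aemeasurable hfm.aestronglyMeasurable,
    integral_map (measurable_consecutive hY n).aemeasurable hfm.aestronglyMeasurable] at h1
  rw [integral_processLaw hX hF.measurable, integral_processLaw hY hF.measurable]
  convert h1 using 3 with ω ω
  · exact (hdep fun i => X i ω).symm
  · exact (hdep fun i => Y i ω).symm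

/-- A function of one coordinate is modular, so it and its negative are both supermodular, and the
inequality becomes an equality. -/
lemma SupermodularLE.map_eq [IsProbabilityMeasure P] [IsProbabilityMeasure Q] (hb : IsWeight b)
    (hX : ∀ i, Measurable (X i)) (hY : ∀ i, Measurable (Y i)) {n : ℕ}
    (h : SupermodularLE b (consecutiveLaw P X n) (consecutiveLaw Q Y n)) :
    P.map (X n) = Q.map (Y n) := by
  have := Measure.isProbabilityMeasure_map (μ := P) (hX n).aemeasurable
  have := Measure.isProbabilityMeasure_map (μ := Q) (hY n).aemeasurable
  have key : ∀ g : ℝ → ℝ, Measurable g → (∀ u, |g u| ≤ 1) →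
      ∫ u, g u ∂P.map (X n) ≤ ∫ u, g u ∂Q.map (Y n) := by
    intro g hg hg1
    have hF : IsTest (fun x : ℕ → ℝ => g (x n)) {n, n + 1} :=
      ⟨hg.comp (measurable_pi_apply n), ⟨1, fun x => hg1 _⟩, fun x y hxy => by
        simp only [hxy n (by simp)]⟩
    have hs : SeqSupermodular fun x : ℕ → ℝ => g (x n) := by
      intro x y
      rcases le_total (x n) (y n) with h | h
      · simp [h]
      · simp [h, add_comm]
    have h1 := h.integral_test_le hb hX hY hF hs
    rw [integral_processLaw hX hF.measurable, integral_processLaw hY hF.measurable] at h1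
    rwa [integral_map (hX n).aemeasurable hg.aestronglyMeasurable,
      integral_map (hY n).aemeasurable hg.aestronglyMeasurable]
  ext B hB
  have hm : Measurable (B.indicator fun _ => (1 : ℝ)) := measurable_const.indicator hB
  have habs : ∀ u, |B.indicator (fun _ => (1 : ℝ)) u| ≤ 1 := fun u => by
    by_cases hu : u ∈ B <;> simp [hu]
  have h1 := key _ hm habs
  have h2 := key (fun u => -B.indicator (fun _ => (1 : ℝ)) u) hm.neg fun u => by
    rw [abs_neg]; exact habs u
  rw [integral_neg, integral_neg] at h2
  have h3 := le_antisymm h1 (neg_le_neg_iff.1 h2)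
  rw [integral_indicator_const _ hB, integral_indicator_const _ hB, smul_eq_mul, smul_eq_mul,
    mul_one, mul_one] at h3
  exact (measureReal_eq_measureReal_iff).1 h3

end Consecutive

/-! ### Positive supermodular dependence and the main theorem. -/

section Markov

variable {Ω : Type*} [MeasurableSpace Ω] {P : Measure Ω} [IsProbabilityMeasure P] {X : ℕ → Ω → ℝ}
  {b : (d : ℕ) → (Fin d → ℝ) → ℝ}

lemma IsMarkovProcess.disintegrates_backward (hX : IsMarkovProcess P X) (n N : ℕ) :
    Disintegrates (processLaw P X) (condDistrib (X n) (X (n + 1)) P) (n + 1) n (Icc n N) :=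
  Disintegrates.backward (κ := fun n => condDistrib (X (n + 1)) (X n) P) hX.disintegrates
    (disintegrates_condDistrib hX.1 (n + 1) n) N

lemma isPSMD_of_clampedLE (hX : ∀ i, Measurable (X i)) (hb : ∀ d, IsWeight (b d))
    (hbX : MarginallyIntegrable b P X) (h : ClampedLE (independentLaw P X) (processLaw P X)) :
    IsPSMD b P X := by
  have : ∀ i, IsProbabilityMeasure (P.map (X i)) := fun i =>
    Measure.isProbabilityMeasure_map (hX i).aemeasurable
  have := isProbabilityMeasure_processLaw (P := P) hX
  have : IsProbabilityMeasure (independentLaw P X) := by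
    unfold independentLaw; infer_instance
  have hm : ∀ i, (independentLaw P X).map (fun x => x i) = P.map (X i) :=
    map_eval_infinitePi fun i => P.map (X i)
  refine h.processSupermodularLE (fun i => by rw [hm, map_eval_processLaw hX]) hb fun m n => ?_
  simpa only [hm] using hbX m n

/-- Here `X` is the forward chain and the independent sequence the backward one, so the relation is
`≥`. -/
theorem IsMarkovProcess.isPSMD_of_forward (hX : IsMarkovProcess P X) (hb : ∀ d, IsWeight (b d))
    (hbX : MarginallyIntegrable b P X)
    (hup : ∀ i, StochasticallyIncreasing P (X (i + 1)) (X i)) : IsPSMD b P X := by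
  have hprob : ∀ i, IsProbabilityMeasure (P.map (X i)) := fun i =>
    Measure.isProbabilityMeasure_map (hX.1 i).aemeasurable
  have := isProbabilityMeasure_processLaw (P := P) hX.1
  refine isPSMD_of_clampedLE hX.1 hb hbX fun N F K hF hs hK hclamp => ?_
  refine comparison_of_aeStochIncreasing (r := fun a c => c ≤ a)
    (κ := fun n => condDistrib (X (n + 1)) (X n) P) (η := fun n => Kernel.const ℝ (P.map (X n)))
    (fun _ => le_rfl) (fun _ _ _ h1 h2 => h2.trans h1) hX.disintegrates
    (fun n N => disintegrates_infinitePi _ _ _ _) (fun n => (hup n).aeStochIncreasing hX.1)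
    (fun n => aeStochIncreasing_const _ _ _) ?_ ?_ hF hs hK hclamp
  · intro n G hG
    refine integral_eq_of_map_eval_eq ?_ hG
    rw [map_eval_processLaw hX.1]
    exact (map_eval_infinitePi (fun i => P.map (X i)) n).symm
  · intro n G hG hGs
    refine integral_independent_le_of_aeStochIncreasing (by omega) ?_
      ((hup n).aeStochIncreasing hX.1) hG hGs _ (map_eval_processLaw hX.1)
    rw [pair_comm]
    exact disintegrates_condDistrib hX.1 n (n + 1)

/-- The roles are exchanged: the independent sequence is the forward chain, and the relation is `≤`.
-/
theorem IsMarkovProcess.isPSMD_of_backward (hX : IsMarkovProcess P X) (hb : ∀ d, IsWeight (b d))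
    (hbX : MarginallyIntegrable b P X)
    (hup : ∀ i, StochasticallyIncreasing P (X i) (X (i + 1))) : IsPSMD b P X := by
  have hprob : ∀ i, IsProbabilityMeasure (P.map (X i)) := fun i =>
    Measure.isProbabilityMeasure_map (hX.1 i).aemeasurable
  have := isProbabilityMeasure_processLaw (P := P) hX.1
  refine isPSMD_of_clampedLE hX.1 hb hbX fun N F K hF hs hK hclamp => ?_
  refine comparison_of_aeStochIncreasing (r := fun a c => a ≤ c)
    (κ := fun n => Kernel.const ℝ (P.map (X (n + 1))))
    (η := fun n => condDistrib (X n) (X (n + 1)) P)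
    (fun _ => le_rfl) (fun _ _ _ h1 h2 => h1.trans h2)
    (fun n => disintegrates_infinitePi _ _ _ _) hX.disintegrates_backward
    (fun n => aeStochIncreasing_const _ _ _) (fun n => (hup n).aeStochIncreasing hX.1)
    ?_ ?_ hF hs hK hclamp
  · intro n G hG
    refine integral_eq_of_map_eval_eq ?_ hG
    rw [map_eval_processLaw hX.1]
    exact map_eval_infinitePi (fun i => P.map (X i)) n
  · intro n G hG hGs
    rw [pair_comm] at hG
    refine integral_independent_le_of_aeStochIncreasing (by omega) ?_
      ((hup n).aeStochIncreasing hX.1) hG hGs _ (map_eval_processLaw hX.1)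
    rw [pair_comm]
    exact disintegrates_condDistrib hX.1 (n + 1) n

end Markov

theorem proposition1p1 {Ω Ω' : Type*} [MeasurableSpace Ω] [MeasurableSpace Ω']
    (P : Measure Ω) [IsProbabilityMeasure P] (Q : Measure Ω') [IsProbabilityMeasure Q]
    (X : ℕ → Ω → ℝ) (Y : ℕ → Ω' → ℝ)
    (b : (d : ℕ) → (Fin d → ℝ) → ℝ) (hb : ∀ d, IsWeight (b d))
    (hbX : MarginallyIntegrable b P X) (hbY : MarginallyIntegrable b Q Y)
    (hX : IsMarkovProcess P X) (hY : IsMarkovProcess Q Y)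
    (hXup : ∀ i, StochasticallyIncreasing P (X (i + 1)) (X i))
    (hYup : ∀ i, StochasticallyIncreasing Q (Y i) (Y (i + 1))) :
    ((∀ i, SupermodularLE (b 2) (consecutiveLaw P X i) (consecutiveLaw Q Y i)) →
      ProcessSupermodularLE b (processLaw P X) (processLaw Q Y) ∧
        IsPSMD b P X ∧ IsPSMD b Q Y) ∧
    ((∀ i, SupermodularLE (b 2) (consecutiveLaw Q Y i) (consecutiveLaw P X i)) →
      ProcessSupermodularLE b (processLaw Q Y) (processLaw P X) ∧
        IsPSMD b P X ∧ IsPSMD b Q Y) := by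
  have := isProbabilityMeasure_processLaw (P := P) hX.1
  have := isProbabilityMeasure_processLaw (P := Q) hY.1
  have hpsX := hX.isPSMD_of_forward hb hbX hXup
  have hpsY := hY.isPSMD_of_backward hb hbY hYup
  refine ⟨fun h => ⟨?_, hpsX, hpsY⟩, fun h => ⟨?_, hpsX, hpsY⟩⟩
  · have hmarg : ∀ i, (processLaw P X).map (fun x => x i) = (processLaw Q Y).map fun x => x i :=
      fun i => by
        rw [map_eval_processLaw hX.1, map_eval_processLaw hY.1]
        exact (h i).map_eq (hb 2) hX.1 hY.1
    refine ClampedLE.processSupermodularLE (fun N F K hF hs hK hclamp => ?_) hmarg hb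
      fun m n => by simpa only [map_eval_processLaw hX.1] using hbX m n
    exact comparison_of_aeStochIncreasing (r := fun a c => a ≤ c)
      (κ := fun n => condDistrib (X (n + 1)) (X n) P)
      (η := fun n => condDistrib (Y n) (Y (n + 1)) Q)
      (fun _ => le_rfl) (fun _ _ _ h1 h2 => h1.trans h2) hX.disintegrates
      hY.disintegrates_backward (fun n => (hXup n).aeStochIncreasing hX.1)
      (fun n => (hYup n).aeStochIncreasing hY.1)
      (fun n G hG => integral_eq_of_map_eval_eq (hmarg n) hG)
      (fun n G hG hGs => (h n).integral_test_le (hb 2) hX.1 hY.1 hG hGs) hF hs hK hclamp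
  · have hmarg : ∀ i, (processLaw Q Y).map (fun x => x i) = (processLaw P X).map fun x => x i :=
      fun i => by
        rw [map_eval_processLaw hX.1, map_eval_processLaw hY.1]
        exact (h i).map_eq (hb 2) hY.1 hX.1
    refine ClampedLE.processSupermodularLE (fun N F K hF hs hK hclamp => ?_) hmarg hb
      fun m n => by simpa only [map_eval_processLaw hY.1] using hbY m n
    -- `X` remains the forward chain and `Y` the backward one, as their monotonicity requires; only
    -- the relation is reversed.
    exact comparison_of_aeStochIncreasing (r := fun a c => c ≤ a)
      (κ := fun n => condDistrib (X (n + 1)) (X n) P)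
      (η := fun n => condDistrib (Y n) (Y (n + 1)) Q)
      (fun _ => le_rfl) (fun _ _ _ h1 h2 => h2.trans h1) hX.disintegrates
      hY.disintegrates_backward (fun n => (hXup n).aeStochIncreasing hX.1)
      (fun n => (hYup n).aeStochIncreasing hY.1)
      (fun n G hG => integral_eq_of_map_eval_eq (hmarg n).symm hG)
      (fun n G hG hGs => (h n).integral_test_le (hb 2) hY.1 hX.1 hG hGs) hF hs hK hclamp
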